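/- **Setting.** Let $K\subseteq F$ be fields. Let $\bigoplus_{k\ge 0}\Omega_k$ be a commutative graded $F$-algebra with $\Omega_0=F$ whose completion $\Omega=\prod_k\Omega_k$ with respect to the degree filtration has no zero divisors. For a commutative $F$-algebra $R$ let $R\otimes\Omega$ be the completion with homogeneous components $R\otimes_F\Omega_k$. A *higher derivation* $R\to R\otimes\Omega$ is a $K$-algebra homomorphism $\psi=\sum_k\psi^{(k)}$, $\psi^{(k)}:R\to R\otimes_F\Omega_k$, with $\psi^{(0)}=\mathrm{id}_R$. It is *iterable* if the components $R\otimes_F\Omega_k$ are generated by the elements $\psi^{(j)}(r)$ (that is, lie in the $R$-subalgebra that these generate), and $\psi$ extends to a continuous $K$-algebra endomorphism of $R\otimes\Omega$ (again denoted $\psi$) that is positive, i.e. has no homogeneous components $\psi^{(i)}$ of degree $i<0$, and whose homogeneous components satisfy $\psi^{(i)}\circ\psi^{(j)}=\binom{i+j}{i}\psi^{(i+j)}$ for all $i,j\geq 0$. Fix an iterable higher derivation $\theta:F\to\Omega$ with $K=\{t\in F\mid\theta(t)=t\}$. A *$\theta$-ring* is a commutative $F$-algebra $R$ with an iterable higher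 derivation $\theta_R:R\to R\otimes\Omega$ extending $\theta$; its ring of constants is $C_R=\{r\in R\mid\theta_R(r)=r\otimes1\}$. An ideal $I$ of $R$ is a $\theta$-ideal if $\theta_R^{(k)}(I)\subseteq I\otimes_F\Omega_k$ for all $k$, and $R\neq 0$ is *$\theta$-simple* if $0$ and $R$ are its only $\theta$-ideals. An $F$-algebra homomorphism $f:R\to R'$ is a $\theta$-homomorphism if $\theta_{R'}\circ f=(f\otimes\mathrm{id})\circ\theta_R$. On $R\otimes_FR'$ one uses $\theta^{(k)}(r\otimes r')=\sum_{i+j=k}\theta_R^{(i)}(r)\,\theta_{R'}^{(j)}(r')$, and for a commutative $K$-algebra $L$ one extends $\theta$ trivially to $R_L=R\otimes_KL$ by $\theta(r\otimes a)=\theta_R(r)\otimes a$; put $F_L=F\otimes_KL$. A $\theta$-ring $R$ is a *PPV-ring* over $F$ if there is an iterable higher differential equation $\theta(\mathbf y)=A\mathbf y$, that is, $A=\sum_kA_k\in\mathrm{GL}_n(\Omega)$ with $A_0=1$ and $\binom{k+l}{l}A_{k+l}=\sum_{i+j=l}\theta^{(i)}(A_k)A_j$ for all $k,l\ge 0$,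 such that $R$ is $\theta$-simple, there is $Y\in\mathrm{GL}_n(R)$ with $\theta_R(Y)=AY$ such that $R$ is generated as an $F$-algebra by the entries of $Y$ and $\det(Y)^{-1}$, and $C_R=K$. **Statement.** Let $R$ be a PPV-ring over $F$, and let $U=C_{R\otimes_FR}$. 1. $U$ is a finitely generated $K$-algebra, and it represents the group functor $\mathcal G: L\mapsto\mathrm{Aut}^\theta(R_L/F_L)$ (the group of $\theta$-automorphisms of $R_L$ fixing the elements of $F_L$) on commutative $K$-algebras, i.e. there is a bijection $\mathrm{Hom}_{K\text{-alg}}(U,L)\cong\mathcal G(L)$ natural in $L$. Hence $\mathcal G$ is an affine group scheme of finite type over $K$, the Galois group scheme of $R/F$. 2. $\mathrm{Spec}(R)$ is a $\mathcal G_F$-torsor, where $\mathcal G_F=\mathcal G\times_KF$: for every commutative $F$-algebra $S$ let $g\in\mathcal G_F(S)=\mathrm{Aut}^\theta(R_S/F_S)$ act on an $S$-point of $\mathrm{Spec}(R)$, i.e. on an $F$-algebra homomorphism $x:R\to S$, from the right by letting $x\cdot g$ be the composite $R\to R_S\xrightarrow{\,g\,}R_S\to S$ of $r\mapsto r\otimes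 1$, $g$, and $r\otimes s\mapsto x(r)s$. This is a right action of $\mathcal G_F$ on $\mathrm{Spec}(R)$, the morphism $\mathrm{Spec}(R)\times_F\mathcal G_F\to\mathrm{Spec}(R)\times_F\mathrm{Spec}(R)$, $(x,g)\mapsto(x,x\cdot g)$, is an isomorphism, and $R$ is faithfully flat and of finite presentation over $F$. -/

import Mathlib

open scoped TensorProduct PowerSeries
open CategoryTheory

set_option linter.unusedSectionVars false

namespace PPV

noncomputable section

universe u

/-! ### Completions of graded algebras and higher derivations -/

section Generic

variable {K S B : Type*} [CommRing K] [CommRing S] [Algebra K S] [CommRing B] [Algebra S B]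
  [Algebra K B] [IsScalarTower K S B]

/-- The completion of the graded `S`-algebra `⨁ₖ 𝒜 k` with respect to the filtration by degree.
Its elements are the formal sums `∑ₖ bₖ` with `bₖ ∈ 𝒜 k`, multiplied by the Cauchy product; such a
sum is recorded as the power series `∑ₖ bₖ Tᵏ` over `B`, so that `PowerSeries.coeff k` is the
projection to the `k`-th homogeneous component. -/
def Cga (𝒜 : ℕ → Submodule S B) [SetLike.GradedMonoid 𝒜] : Subalgebra S B⟦X⟧ where
  carrier := {f | ∀ k, PowerSeries.coeff k f ∈ 𝒜 k}
  mul_mem' {f g} hf hg k := by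
    rw [PowerSeries.coeff_mul]
    refine Submodule.sum_mem _ fun p hp => ?_
    rw [← Finset.HasAntidiagonal.mem_antidiagonal.1 hp]
    exact SetLike.mul_mem_graded (hf _) (hg _)
  add_mem' {f g} hf hg k := by
    rw [map_add]
    exact Submodule.add_mem _ (hf k) (hg k)
  algebraMap_mem' s k := by
    rw [PowerSeries.algebraMap_apply, PowerSeries.coeff_C]
    split_ifs with h
    · subst h
      exact SetLike.algebraMap_mem_graded 𝒜 s
    · exact Submodule.zero_mem _

/-- A homogeneous element `b ∈ 𝒜 m`, as an element of the completion. -/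
def Cga.single {𝒜 : ℕ → Submodule S B} [SetLike.GradedMonoid 𝒜] (m : ℕ) (b : 𝒜 m) : Cga 𝒜 :=
  ⟨PowerSeries.monomial m (b : B), fun k => by
    rw [PowerSeries.coeff_monomial]
    split_ifs with h
    · subst h
      exact b.2
    · exact Submodule.zero_mem _⟩

/-- The `k`-th homogeneous component of an element of the completion. -/
def Cga.comp {𝒜 : ℕ → Submodule S B} [SetLike.GradedMonoid 𝒜] (k : ℕ) (f : Cga 𝒜) : 𝒜 k :=
  ⟨PowerSeries.coeff k (f : B⟦X⟧), f.2 k⟩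

/-- The homogeneous component `g⁽ⁱ⁾` of an endomorphism `g` of the completion, restricted to
degree `m`: `g⁽ⁱ⁾ = pr_{m+i} ∘ g : 𝒜 m → 𝒜 (m + i)`. -/
def Cga.homComp {𝒜 : ℕ → Submodule S B} [SetLike.GradedMonoid 𝒜] (g : Cga 𝒜 →ₐ[K] Cga 𝒜)
    (i m : ℕ) (b : 𝒜 m) : 𝒜 (m + i) :=
  Cga.comp (m + i) (g (Cga.single m b))

/-- A higher derivation of `S` over `K` into the completion of `⨁ₖ 𝒜 k`: a `K`-algebra
homomorphism `ψ` from `S` to the completion with `ε ∘ ψ` the structure map `S → 𝒜 0`, where `ε` is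
the projection to degree `0`. The component `ψ⁽ᵏ⁾ r` is `PowerSeries.coeff k (ψ r)`. -/
structure HigherDerivation (K : Type*) {S B : Type*} [CommRing K] [CommRing S] [Algebra K S]
    [CommRing B] [Algebra S B] [Algebra K B] [IsScalarTower K S B] (𝒜 : ℕ → Submodule S B) where
  toAlgHom : S →ₐ[K] B⟦X⟧
  coeff_mem : ∀ k r, PowerSeries.coeff k (toAlgHom r) ∈ 𝒜 k
  coeff_zero : ∀ r, PowerSeries.coeff 0 (toAlgHom r) = algebraMap S B r

namespace HigherDerivation

variable {𝒜 : ℕ → Submodule S B}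

/-- The ring of constants `{r ∈ S | θ r = r}` (where `S` is embedded in the completion through
degree `0`). -/
def constants (θ : HigherDerivation K 𝒜) : Subalgebra K S where
  carrier := {r | θ.toAlgHom r = PowerSeries.C (algebraMap S B r)}
  mul_mem' {a b} ha hb := by
    simp only [Set.mem_ofPred_eq] at ha hb ⊢
    rw [map_mul, ha, hb, map_mul, map_mul]
  add_mem' {a b} ha hb := by
    simp only [Set.mem_ofPred_eq] at ha hb ⊢
    rw [map_add, ha, hb, map_add, map_add]
  algebraMap_mem' c := by
    simp only [Set.mem_ofPred_eq]
    rw [AlgHom.commutes, PowerSeries.algebraMap_apply, ← IsScalarTower.algebraMap_apply]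

/-- `Θ` is a positive continuous `K`-algebra endomorphism of the completion which extends the
higher derivation `θ` and satisfies the iteration rule `Θ⁽ⁱ⁾ ∘ Θ⁽ʲ⁾ = (i+j choose i) Θ⁽ⁱ⁺ʲ⁾`.
Positivity and continuity together mean that `Θ` preserves every step of the filtration by
degree. -/
structure IsIterativeExtension [SetLike.GradedMonoid 𝒜] (θ : HigherDerivation K 𝒜)
    (Θ : Cga 𝒜 →ₐ[K] Cga 𝒜) : Prop where
  filtered : ∀ (N : ℕ) (f : Cga 𝒜), (∀ j < N, PowerSeries.coeff j (f : B⟦X⟧) = 0) →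
    ∀ j < N, PowerSeries.coeff j (Θ f : B⟦X⟧) = 0
  extend : ∀ r : S, (Θ (algebraMap S (Cga 𝒜) r) : B⟦X⟧) = θ.toAlgHom r
  iterate : ∀ (i j m : ℕ) (b : 𝒜 m),
    (Cga.homComp Θ i (m + j) (Cga.homComp Θ j m b) : B) =
      ((i + j).choose i) • (Cga.homComp Θ (i + j) m b : B)

/-- A higher derivation is iterable if the homogeneous components of the target are generated by
the elements `θ⁽ʲ⁾ r` and if it extends to an endomorphism of the completion that satisfies the
iteration rule. "Generated" means that every `𝒜 k` lies in the `S`-subalgebra generated by all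
`θ⁽ʲ⁾ r`; the universal higher derivation of a field has this property, whereas its components
are in general not spanned by the `θ⁽ᵏ⁾ r` as modules. (If every `𝒜 k` is spanned by the `θ⁽ᵏ⁾ r`,
then this condition holds as well.) -/
structure IsIterable [SetLike.GradedMonoid 𝒜] (θ : HigherDerivation K 𝒜) : Prop where
  generated : ∀ k, 𝒜 k ≤ Subalgebra.toSubmodule
    (Algebra.adjoin S {b : B | ∃ (j : ℕ) (r : S), b = PowerSeries.coeff j (θ.toAlgHom r)})
  exists_extension : ∃ Θ : Cga 𝒜 →ₐ[K] Cga 𝒜, θ.IsIterativeExtension Θ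

/-- The equation `θ(y) = A y` is an iterable higher differential equation:
`A = ∑ₖ Aₖ` is invertible, `A₀ = 1`, and
`(k+l choose l) A_{k+l} = ∑_{i+j=l} θ⁽ⁱ⁾(A_k) A_j`, where `θ` has been extended to the
completion. -/
structure IsIterableEquation [SetLike.GradedMonoid 𝒜] (θ : HigherDerivation K 𝒜) {n : ℕ}
    (A : GL (Fin n) (Cga 𝒜)) : Prop where
  comp_zero : ∀ a b, (Cga.comp 0 (A.val a b) : B) = (1 : Matrix (Fin n) (Fin n) B) a b
  iterate : ∃ Θ : Cga 𝒜 →ₐ[K] Cga 𝒜, θ.IsIterativeExtension Θ ∧ ∀ (k l : ℕ) (a b : Fin n),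
    ((k + l).choose l) • (Cga.comp (k + l) (A.val a b) : B) =
      ∑ p ∈ Finset.HasAntidiagonal.antidiagonal l, ∑ c : Fin n,
        (Cga.homComp Θ p.1 k (Cga.comp k (A.val a c)) : B) * (Cga.comp p.2 (A.val c b) : B)

end HigherDerivation

end Generic

/-! ### Rings with a higher derivation extending `θ` -/

section Theta

variable {K F B : Type*} [Field K] [Field F] [Algebra K F] [CommRing B] [Algebra F B]
  [Algebra K B] [IsScalarTower K F B] {𝒜 : ℕ → Submodule F B} [GradedAlgebra 𝒜]

/-- For an `F`-algebra `R`, a higher derivation `R → R ⊗ Ω` over `K` which extends `θ : F → Ω`.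
Here `Ω` is the completion of `⨁ₖ 𝒜 k`, and `R ⊗ Ω` is the completion with homogeneous components
`R ⊗ 𝒜 k`. -/
structure Extension (θ : HigherDerivation K 𝒜) (R : Type*) [CommRing R] [Algebra F R]
    [Algebra K R] [IsScalarTower K F R] extends
    HigherDerivation K (fun k => (𝒜 k).baseChange R) where
  extend : ∀ a : F, toAlgHom (algebraMap F R a) = PowerSeries.map
    (Algebra.TensorProduct.includeRight : B →ₐ[F] R ⊗[F] B).toRingHom (θ.toAlgHom a)

/-- The map `f ⊗ id : R ⊗ Ω → R' ⊗ Ω` induced by a homomorphism `f : R → R'` of `F`-algebras. -/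
def mapCga (B : Type*) [CommRing B] [Algebra F B] {R R' : Type*} [CommRing R] [Algebra F R]
    [CommRing R'] [Algebra F R'] (f : R →ₐ[F] R') : (R ⊗[F] B)⟦X⟧ →+* (R' ⊗[F] B)⟦X⟧ :=
  PowerSeries.map (Algebra.TensorProduct.map f (AlgHom.id F B)).toRingHom

theorem mapCga_comp_apply {R R' R'' : Type*} [CommRing R] [Algebra F R]
    [CommRing R'] [Algebra F R'] [CommRing R''] [Algebra F R''] (g : R' →ₐ[F] R'')
    (f : R →ₐ[F] R') (x : (R ⊗[F] B)⟦X⟧) :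
    mapCga B g (mapCga B f x) = mapCga B (g.comp f) x := by
  ext k
  simp only [mapCga, PowerSeries.coeff_map, AlgHom.toRingHom_eq_coe, RingHom.coe_coe]
  rw [← AlgHom.comp_apply, ← Algebra.TensorProduct.map_comp, AlgHom.id_comp]

theorem mapCga_id_apply {R : Type*} [CommRing R] [Algebra F R] (x : (R ⊗[F] B)⟦X⟧) :
    mapCga B (AlgHom.id F R) x = x := by
  ext k
  simp [mapCga]

theorem mapCga_C {R R' : Type*} [CommRing R] [Algebra F R]
    [CommRing R'] [Algebra F R'] (f : R →ₐ[F] R') (r : R) :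
    mapCga B f (PowerSeries.C (algebraMap R (R ⊗[F] B) r)) =
      PowerSeries.C (algebraMap R' (R' ⊗[F] B) (f r)) := by
  simp [mapCga, Algebra.TensorProduct.algebraMap_apply]

theorem mapCga_mem {R R' : Type*} [CommRing R] [Algebra F R]
    [CommRing R'] [Algebra F R'] (f : R →ₐ[F] R') (x : (R ⊗[F] B)⟦X⟧)
    (hx : x ∈ Cga (fun k => (𝒜 k).baseChange R)) :
    mapCga B f x ∈ Cga (fun k => (𝒜 k).baseChange R') := by
  intro k
  have h : PowerSeries.coeff k x ∈ (𝒜 k).baseChange R := hx k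
  change PowerSeries.coeff k (mapCga B f x) ∈ (𝒜 k).baseChange R'
  simp only [mapCga, PowerSeries.coeff_map, AlgHom.toRingHom_eq_coe, RingHom.coe_coe]
  generalize PowerSeries.coeff k x = y at h
  rw [Submodule.baseChange_eq_span] at h
  refine Submodule.span_induction ?_ ?_ ?_ ?_ h
  · rintro _ ⟨b, hb, rfl⟩
    simpa using Submodule.tmul_mem_baseChange_of_mem (1 : R') hb
  · simp
  · intro a b _ _ ha hb
    rw [map_add]
    exact Submodule.add_mem _ ha hb
  · intro r a _ ha
    have : r • a = (r ⊗ₜ[F] (1 : B)) * a := by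
      rw [Algebra.smul_def, Algebra.TensorProduct.algebraMap_apply]; rfl
    rw [this, map_mul, Algebra.TensorProduct.map_tmul, map_one]
    have h2 : ∀ z : R' ⊗[F] B, (f r ⊗ₜ[F] (1 : B)) * z = f r • z := fun z => by
      rw [Algebra.smul_def, Algebra.TensorProduct.algebraMap_apply]; rfl
    rw [h2]
    exact Submodule.smul_mem _ _ ha

namespace Extension

variable {θ : HigherDerivation K 𝒜}

section Basic

variable {R : Type*} [CommRing R] [Algebra F R] [Algebra K R] [IsScalarTower K F R]

/-- An ideal `I` with `θ_R⁽ᵏ⁾(I) ⊆ I ⊗ Ωₖ` for all `k`. (As `F` is a field, `I ⊗ Ωₖ` is a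
subspace of `R ⊗ Ωₖ`.) -/
def IsThetaIdeal (D : Extension θ R) (I : Ideal R) : Prop :=
  ∀ (k : ℕ), ∀ r ∈ I, PowerSeries.coeff k (D.toAlgHom r) ∈
    LinearMap.range (TensorProduct.map (I.restrictScalars F).subtype (𝒜 k).subtype)

/-- `R` is nonzero and has no `θ`-ideals besides `0` and `R`. -/
def IsThetaSimple (D : Extension θ R) : Prop :=
  Nontrivial R ∧ ∀ I : Ideal R, D.IsThetaIdeal I → I = ⊥ ∨ I = ⊤

/-- `R` is a pseudo Picard-Vessiot ring for the equation `θ(y) = A y`. -/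
structure IsPPVRingFor (D : Extension θ R) {n : ℕ} (A : GL (Fin n) (Cga 𝒜)) : Prop where
  iterable : D.toHigherDerivation.IsIterable
  simple : D.IsThetaSimple
  /-- There is an invertible matrix `Y` with `θ_R(Y) = A Y` whose entries together with
  `det(Y)⁻¹` generate `R`. -/
  fundamental : ∃ Y : GL (Fin n) R,
    Y.val.map D.toAlgHom =
      A.val.map (fun x => PowerSeries.map
        (Algebra.TensorProduct.includeRight : B →ₐ[F] R ⊗[F] B).toRingHom (x : B⟦X⟧)) *
      Y.val.map (fun y => PowerSeries.C (algebraMap R (R ⊗[F] B) y)) ∧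
    Algebra.adjoin F
      ((Set.range fun p : Fin n × Fin n => Y.val p.1 p.2) ∪ {Y⁻¹.val.det}) = ⊤
  constants : D.toHigherDerivation.constants = ⊥

/-- `R` is a pseudo Picard-Vessiot ring over `F`, that is, for some iterable higher differential
equation over `F`. -/
def IsPPVRing (D : Extension θ R) : Prop :=
  ∃ (n : ℕ) (A : GL (Fin n) (Cga 𝒜)), θ.IsIterableEquation A ∧ D.IsPPVRingFor A

/-- A homomorphism `f` of `F`-algebras is a `θ`-homomorphism if
`θ_{R'} ∘ f = (f ⊗ id) ∘ θ_R`. -/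
def IsThetaHom {R' : Type*} [CommRing R'] [Algebra F R'] [Algebra K R'] [IsScalarTower K F R']
    (D : Extension θ R) (D' : Extension θ R') (f : R →ₐ[F] R') : Prop :=
  ∀ x, D'.toAlgHom (f x) = mapCga B f (D.toAlgHom x)

/-- The group of `θ`-automorphisms of `R` that fix the elements of `R₀` (where `F ≤ R₀ ≤ R`). -/
def thetaAut (D : Extension θ R) (R₀ : Subalgebra F R) : Subgroup (R ≃ₐ[F] R) where
  carrier := {σ | D.IsThetaHom D (σ : R →ₐ[F] R) ∧ ∀ x ∈ R₀, σ x = x}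
  mul_mem' {σ τ} hσ hτ := by
    refine ⟨fun x => ?_, fun x hx => ?_⟩
    · have h1 := hσ.1 (τ x)
      have h2 := hτ.1 x
      simp only [AlgEquiv.coe_toAlgHom] at h1 h2
      have h3 : ((σ * τ : R ≃ₐ[F] R) : R →ₐ[F] R) = (σ : R →ₐ[F] R).comp (τ : R →ₐ[F] R) := rfl
      rw [h3, ← mapCga_comp_apply]
      simp only [AlgHom.comp_apply, AlgEquiv.coe_toAlgHom]
      rw [h1, h2]
    · rw [AlgEquiv.mul_apply, hτ.2 x hx, hσ.2 x hx]
  one_mem' := by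
    refine ⟨fun x => ?_, fun x _ => rfl⟩
    exact (mapCga_id_apply _).symm
  inv_mem' {σ} hσ := by
    refine ⟨fun x => ?_, fun x hx => ?_⟩
    · have h1 := hσ.1 (σ⁻¹ x)
      have h0 : (σ : R →ₐ[F] R) (σ⁻¹ x) = x := σ.apply_symm_apply x
      rw [h0] at h1
      have h3 : ((σ⁻¹ : R ≃ₐ[F] R) : R →ₐ[F] R).comp (σ : R →ₐ[F] R) = AlgHom.id F R := by
        ext y
        exact σ.symm_apply_apply y
      rw [h1, mapCga_comp_apply, h3, mapCga_id_apply]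
      rfl
    · have h := hσ.2 x hx
      calc σ⁻¹ x = σ⁻¹ (σ x) := by rw [h]
        _ = x := σ.symm_apply_apply x

end Basic

/-! ### The tensor product of two `θ`-rings -/

section Tensor

variable {R R' : Type*} [CommRing R] [Algebra F R] [Algebra K R] [IsScalarTower K F R]
  [CommRing R'] [Algebra F R'] [Algebra K R'] [IsScalarTower K F R']

theorem mapCga_extend (D : Extension θ R) (f : R →ₐ[F] R') (a : F) :
    mapCga B f (D.toAlgHom (algebraMap F R a)) = PowerSeries.map
      (Algebra.TensorProduct.includeRight : B →ₐ[F] R' ⊗[F] B).toRingHom (θ.toAlgHom a) := by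
  rw [D.extend]
  ext k
  simp [mapCga]

/-- The additive map `r ⊗ r' ↦ θ_R(r) θ_{R'}(r')` from `R ⊗ R'` to `R ⊗ R' ⊗ Ω`. -/
def tensorAddHom (D : Extension θ R) (D' : Extension θ R') :
    R ⊗[F] R' →+ ((R ⊗[F] R') ⊗[F] B)⟦X⟧ :=
  TensorProduct.liftAddHom
    ((AddMonoidHom.mul.comp
        ((mapCga B (Algebra.TensorProduct.includeLeft : R →ₐ[F] R ⊗[F] R')).toAddMonoidHom.comp
          D.toAlgHom.toRingHom.toAddMonoidHom)).compr₂ (AddMonoidHom.id _) |>.compl₂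
        ((mapCga B (Algebra.TensorProduct.includeRight : R' →ₐ[F] R ⊗[F] R')).toAddMonoidHom.comp
          D'.toAlgHom.toRingHom.toAddMonoidHom))
    (fun a r r' => by
      change mapCga B _ (D.toAlgHom (a • r)) * mapCga B _ (D'.toAlgHom r') =
        mapCga B _ (D.toAlgHom r) * mapCga B _ (D'.toAlgHom (a • r'))
      rw [Algebra.smul_def, Algebra.smul_def, map_mul, map_mul, map_mul, map_mul,
        mapCga_extend, mapCga_extend]
      ring)

theorem tensorAddHom_tmul (D : Extension θ R) (D' : Extension θ R') (r : R) (r' : R') :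
    tensorAddHom D D' (r ⊗ₜ r') =
      mapCga B (Algebra.TensorProduct.includeLeft : R →ₐ[F] R ⊗[F] R') (D.toAlgHom r) *
      mapCga B (Algebra.TensorProduct.includeRight : R' →ₐ[F] R ⊗[F] R') (D'.toAlgHom r') :=
  rfl

/-- The tensor product `R ⊗_F R'`, with
`θ⁽ᵏ⁾(r ⊗ r') = ∑_{i+j=k} θ_R⁽ⁱ⁾(r) θ_{R'}⁽ʲ⁾(r')`. -/
def tensor (D : Extension θ R) (D' : Extension θ R') : Extension θ (R ⊗[F] R') where
  toAlgHom :=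
    { tensorAddHom D D' with
      map_one' := by
        change tensorAddHom D D' 1 = 1
        rw [Algebra.TensorProduct.one_def, tensorAddHom_tmul]
        simp
      map_mul' := fun x y => by
        change tensorAddHom D D' (x * y) = tensorAddHom D D' x * tensorAddHom D D' y
        induction x using TensorProduct.induction_on with
        | zero => simp
        | add x₁ x₂ h₁ h₂ => rw [add_mul, map_add, map_add, add_mul, h₁, h₂]
        | tmul r r' =>
          induction y using TensorProduct.induction_on with
          | zero => simp
          | add y₁ y₂ h₁ h₂ => rw [mul_add, map_add, map_add, mul_add, h₁, h₂]
          | tmul s s' =>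
            rw [Algebra.TensorProduct.tmul_mul_tmul]
            simp only [tensorAddHom_tmul, map_mul]
            ring
      commutes' := fun c => by
        change tensorAddHom D D' (algebraMap K (R ⊗[F] R') c) = _
        rw [Algebra.TensorProduct.algebraMap_apply, tensorAddHom_tmul, AlgHom.commutes]
        simp only [map_one, mul_one]
        rw [PowerSeries.algebraMap_apply, PowerSeries.algebraMap_apply,
          IsScalarTower.algebraMap_apply K R (R ⊗[F] B), mapCga_C,
          IsScalarTower.algebraMap_apply K (R ⊗[F] R') ((R ⊗[F] R') ⊗[F] B)]
        rfl }
  coeff_mem := fun k x => by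
    have key : ∀ x, tensorAddHom D D' x ∈ Cga (fun k => (𝒜 k).baseChange (R ⊗[F] R')) := by
      intro x
      induction x using TensorProduct.induction_on with
      | zero => rw [map_zero]; exact Subalgebra.zero_mem _
      | add x₁ x₂ h₁ h₂ => rw [map_add]; exact Subalgebra.add_mem _ h₁ h₂
      | tmul r r' =>
        rw [tensorAddHom_tmul]
        exact Subalgebra.mul_mem _ (mapCga_mem _ _ fun k => D.coeff_mem k r)
          (mapCga_mem _ _ fun k => D'.coeff_mem k r')
    exact key x k
  coeff_zero := fun x => by
    change PowerSeries.coeff 0 (tensorAddHom D D' x) = _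
    induction x using TensorProduct.induction_on with
    | zero => simp
    | add x₁ x₂ h₁ h₂ => rw [map_add, map_add, map_add, h₁, h₂]
    | tmul r r' =>
      have h0 : ∀ f g : ((R ⊗[F] R') ⊗[F] B)⟦X⟧, PowerSeries.coeff 0 (f * g) =
          PowerSeries.coeff 0 f * PowerSeries.coeff 0 g := fun f g => by
        simp [PowerSeries.coeff_zero_eq_constantCoeff]
      rw [tensorAddHom_tmul, h0]
      simp only [mapCga, PowerSeries.coeff_map, D.coeff_zero, D'.coeff_zero]
      simp [Algebra.TensorProduct.algebraMap_apply]
  extend := fun a => by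
    change tensorAddHom D D' (algebraMap F (R ⊗[F] R') a) = _
    rw [Algebra.TensorProduct.algebraMap_apply, tensorAddHom_tmul, mapCga_extend]
    simp

end Tensor

/-! ### Trivial extension of constants -/

section Triv

variable {R : Type*} [CommRing R] [Algebra F R] [Algebra K R] [IsScalarTower K F R]

/-- The map `L → (R ⊗_K L) ⊗ Ω` that sends `a` to `1 ⊗ a` in degree `0`. -/
def trivConst (B : Type*) [CommRing B] [Algebra F B] [Algebra K B] [IsScalarTower K F B]
    (R : Type*) [CommRing R] [Algebra F R] [Algebra K R] [IsScalarTower K F R]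
    (L : Type*) [CommRing L] [Algebra K L] : L →ₐ[K] ((R ⊗[K] L) ⊗[F] B)⟦X⟧ :=
  { (PowerSeries.C (R := (R ⊗[K] L) ⊗[F] B)).comp
      ((algebraMap (R ⊗[K] L) ((R ⊗[K] L) ⊗[F] B)).comp
        (Algebra.TensorProduct.includeRight : L →ₐ[K] R ⊗[K] L).toRingHom) with
    commutes' := fun c => by
      change PowerSeries.C (algebraMap (R ⊗[K] L) ((R ⊗[K] L) ⊗[F] B)
        ((Algebra.TensorProduct.includeRight : L →ₐ[K] R ⊗[K] L) (algebraMap K L c))) = _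
      rw [AlgHom.commutes, ← IsScalarTower.algebraMap_apply, PowerSeries.algebraMap_apply] }

/-- The map `r ↦ θ_R(r) ⊗ 1` from `R` to `(R ⊗_K L) ⊗ Ω`. -/
def trivLeft (D : Extension θ R) (L : Type*) [CommRing L] [Algebra K L] :
    R →ₐ[K] ((R ⊗[K] L) ⊗[F] B)⟦X⟧ :=
  { (mapCga B (Algebra.TensorProduct.includeLeft : R →ₐ[F] R ⊗[K] L)).comp
      D.toAlgHom.toRingHom with
    commutes' := fun c => by
      change mapCga B (Algebra.TensorProduct.includeLeft : R →ₐ[F] R ⊗[K] L)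
        (D.toAlgHom (algebraMap K R c)) = _
      rw [AlgHom.commutes, PowerSeries.algebraMap_apply, PowerSeries.algebraMap_apply,
        IsScalarTower.algebraMap_apply K R (R ⊗[F] B), mapCga_C,
        IsScalarTower.algebraMap_apply K (R ⊗[K] L) ((R ⊗[K] L) ⊗[F] B)]
      rfl }

/-- The map underlying the trivial extension. -/
def trivHom (D : Extension θ R) (L : Type*) [CommRing L] [Algebra K L] :
    R ⊗[K] L →ₐ[K] ((R ⊗[K] L) ⊗[F] B)⟦X⟧ :=
  Algebra.TensorProduct.lift (D.trivLeft L) (trivConst B R L) (fun _ _ => Commute.all _ _)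

theorem trivHom_tmul (D : Extension θ R) (L : Type*) [CommRing L] [Algebra K L] (r : R) (a : L) :
    D.trivHom L (r ⊗ₜ a) =
      mapCga B (Algebra.TensorProduct.includeLeft : R →ₐ[F] R ⊗[K] L) (D.toAlgHom r) *
        PowerSeries.C (algebraMap (R ⊗[K] L) ((R ⊗[K] L) ⊗[F] B) (1 ⊗ₜ a)) :=
  Algebra.TensorProduct.lift_tmul _ _ _ _ _

/-- The `F`-algebra `R ⊗_K L`, with `θ_R` extended trivially: `θ(r ⊗ a) = θ_R(r) ⊗ a`. -/
def triv (D : Extension θ R) (L : Type*) [CommRing L] [Algebra K L] :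
    Extension θ (R ⊗[K] L) where
  toAlgHom := D.trivHom L
  coeff_mem := fun k x => by
    have key : ∀ x, D.trivHom L x ∈ Cga (fun k => (𝒜 k).baseChange (R ⊗[K] L)) := by
      intro x
      induction x using TensorProduct.induction_on with
      | zero => rw [map_zero]; exact Subalgebra.zero_mem _
      | add x₁ x₂ h₁ h₂ => rw [map_add]; exact Subalgebra.add_mem _ h₁ h₂
      | tmul r a =>
        rw [trivHom_tmul]
        have h := Subalgebra.algebraMap_mem (Cga (fun k => (𝒜 k).baseChange (R ⊗[K] L)))
          ((1 : R) ⊗ₜ[K] a)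
        rw [PowerSeries.algebraMap_apply] at h
        exact Subalgebra.mul_mem _ (mapCga_mem _ _ fun k => D.coeff_mem k r) h
    exact key x k
  coeff_zero := fun x => by
    induction x using TensorProduct.induction_on with
    | zero => simp
    | add x₁ x₂ h₁ h₂ => rw [map_add, map_add, map_add, h₁, h₂]
    | tmul r a =>
      rw [trivHom_tmul, PowerSeries.coeff_mul_C]
      simp only [mapCga, PowerSeries.coeff_map, D.coeff_zero]
      simp [Algebra.TensorProduct.algebraMap_apply]
  extend := fun a => by
    rw [Algebra.TensorProduct.algebraMap_apply, trivHom_tmul]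
    have h : (1 : R ⊗[K] L) = 1 ⊗ₜ 1 := Algebra.TensorProduct.one_def
    rw [← h, map_one, map_one, mul_one, mapCga_extend]

end Triv

end Extension

/-! ### The automorphism functor and torsors -/

section Functor

variable {θ : HigherDerivation K 𝒜} {R : Type*} [CommRing R] [Algebra F R] [Algebra K R]
  [IsScalarTower K F R]

/-- `F_L = F ⊗_K L` as a subalgebra of `R_L = R ⊗_K L`. -/
def scalars (K F R : Type*) [Field K] [Field F] [Algebra K F] [CommRing R] [Algebra F R]
    [Algebra K R] [IsScalarTower K F R] (L : Type*) [CommRing L] [Algebra K L] :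
    Subalgebra F (R ⊗[K] L) :=
  (Algebra.TensorProduct.map (Algebra.ofId F R) (AlgHom.id K L) :
    F ⊗[K] L →ₐ[F] R ⊗[K] L).range

/-- The group `Aut^θ(R_L / F_L)`. -/
def autGroup (D : Extension θ R) (L : Type*) [CommRing L] [Algebra K L] :
    Subgroup ((R ⊗[K] L) ≃ₐ[F] (R ⊗[K] L)) :=
  (D.triv L).thetaAut (scalars K F R L)

theorem autGroup_apply_right (D : Extension θ R) {L : Type*} [CommRing L] [Algebra K L]
    (σ : autGroup D L) (a : L) : σ.1 ((1 : R) ⊗ₜ[K] a) = 1 ⊗ₜ a :=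
  σ.2.2 _ ⟨1 ⊗ₜ a, by simp⟩

/-- The map `id ⊗ φ : R_L → R_{L'}`. -/
def baseMap (F : Type*) [Field F] [Algebra K F] (R : Type*) [CommRing R] [Algebra F R] [Algebra K R]
    [IsScalarTower K F R] {L L' : Type*} [CommRing L] [Algebra K L] [CommRing L'] [Algebra K L']
    (φ : L →ₐ[K] L') : R ⊗[K] L →ₐ[F] R ⊗[K] L' :=
  Algebra.TensorProduct.map (AlgHom.id F R) φ

theorem baseMap_baseMap {L L' L'' : Type*} [CommRing L] [Algebra K L] [CommRing L'] [Algebra K L']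
    [CommRing L''] [Algebra K L''] (φ : L →ₐ[K] L') (ψ : L' →ₐ[K] L'') (x : R ⊗[K] L) :
    baseMap F R ψ (baseMap F R φ x) = baseMap F R (ψ.comp φ) x := by
  induction x using TensorProduct.induction_on with
  | zero => simp
  | add x₁ x₂ h₁ h₂ => simp only [map_add, h₁, h₂]
  | tmul r a => simp [baseMap]

/-- The `L'`-linear extension of `σ : R_L → R_L` along `φ : L → L'`: it sends `r ⊗ a` to
`(id ⊗ φ)(σ(r ⊗ 1)) (1 ⊗ a)`. -/
def autMapHom {L L' : Type*} [CommRing L] [Algebra K L] [CommRing L'] [Algebra K L']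
    (φ : L →ₐ[K] L') (σ : R ⊗[K] L →ₐ[F] R ⊗[K] L) : R ⊗[K] L' →ₐ[F] R ⊗[K] L' :=
  Algebra.TensorProduct.lift
    (((baseMap F R φ).comp σ).comp (Algebra.TensorProduct.includeLeft : R →ₐ[F] R ⊗[K] L))
    (Algebra.TensorProduct.includeRight : L' →ₐ[K] R ⊗[K] L') (fun _ _ => Commute.all _ _)

theorem autMapHom_tmul {L L' : Type*} [CommRing L] [Algebra K L] [CommRing L'] [Algebra K L']
    (φ : L →ₐ[K] L') (σ : R ⊗[K] L →ₐ[F] R ⊗[K] L) (r : R) (a : L') :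
    autMapHom φ σ (r ⊗ₜ a) = baseMap F R φ (σ (r ⊗ₜ 1)) * (1 ⊗ₜ a) :=
  Algebra.TensorProduct.lift_tmul _ _ _ _ _

theorem autMapHom_baseMap (D : Extension θ R) {L L' : Type*} [CommRing L] [Algebra K L]
    [CommRing L'] [Algebra K L'] (φ : L →ₐ[K] L') (σ : autGroup D L) (x : R ⊗[K] L) :
    autMapHom φ (σ.1 : R ⊗[K] L →ₐ[F] R ⊗[K] L) (baseMap F R φ x) = baseMap F R φ (σ.1 x) := by
  induction x using TensorProduct.induction_on with
  | zero => simp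
  | add x₁ x₂ h₁ h₂ => simp only [map_add, h₁, h₂]
  | tmul r a =>
    have h : r ⊗ₜ[K] a = (r ⊗ₜ 1) * ((1 : R) ⊗ₜ a) := by simp
    have h1 : baseMap F R φ (r ⊗ₜ a) = r ⊗ₜ φ a := by simp [baseMap]
    have h2 : baseMap F R φ ((1 : R) ⊗ₜ a) = 1 ⊗ₜ φ a := by simp [baseMap]
    rw [h1, autMapHom_tmul, h, map_mul, map_mul, autGroup_apply_right, h2]
    rfl

theorem autMapHom_comp (D : Extension θ R) {L L' : Type*} [CommRing L] [Algebra K L]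
    [CommRing L'] [Algebra K L'] (φ : L →ₐ[K] L') (σ τ : autGroup D L) (x : R ⊗[K] L') :
    autMapHom φ (σ.1 : R ⊗[K] L →ₐ[F] R ⊗[K] L) (autMapHom φ (τ.1 : R ⊗[K] L →ₐ[F] R ⊗[K] L) x) =
      autMapHom φ ((σ * τ).1 : R ⊗[K] L →ₐ[F] R ⊗[K] L) x := by
  induction x using TensorProduct.induction_on with
  | zero => simp
  | add x₁ x₂ h₁ h₂ => simp only [map_add, h₁, h₂]
  | tmul r a =>
    rw [autMapHom_tmul, autMapHom_tmul, map_mul, AlgEquiv.coe_toAlgHom, autMapHom_baseMap,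
      autMapHom_tmul, AlgEquiv.coe_toAlgHom, ← Algebra.TensorProduct.one_def, map_one, map_one,
      one_mul]
    rfl

theorem autMapHom_one (D : Extension θ R) {L L' : Type*} [CommRing L] [Algebra K L]
    [CommRing L'] [Algebra K L'] (φ : L →ₐ[K] L') (x : R ⊗[K] L') :
    autMapHom φ ((1 : autGroup D L).1 : R ⊗[K] L →ₐ[F] R ⊗[K] L) x = x := by
  induction x using TensorProduct.induction_on with
  | zero => simp
  | add x₁ x₂ h₁ h₂ => simp only [map_add, h₁, h₂]
  | tmul r a =>
    rw [autMapHom_tmul]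
    change baseMap F R φ (r ⊗ₜ 1) * _ = _
    simp [baseMap]

theorem triv_baseMap (D : Extension θ R) {L L' : Type*} [CommRing L] [Algebra K L]
    [CommRing L'] [Algebra K L'] (φ : L →ₐ[K] L') (x : R ⊗[K] L) :
    (D.triv L').toAlgHom (baseMap F R φ x) = mapCga B (baseMap F R φ) ((D.triv L).toAlgHom x) := by
  change D.trivHom L' _ = mapCga B _ (D.trivHom L _)
  induction x using TensorProduct.induction_on with
  | zero => simp
  | add x₁ x₂ h₁ h₂ => simp only [map_add, h₁, h₂]
  | tmul r a =>
    have h1 : baseMap F R φ (r ⊗ₜ a) = r ⊗ₜ φ a := by simp [baseMap]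
    have h2 : baseMap F R φ ((1 : R) ⊗ₜ a) = 1 ⊗ₜ φ a := by simp [baseMap]
    rw [h1, Extension.trivHom_tmul, Extension.trivHom_tmul, map_mul, mapCga_C,
      mapCga_comp_apply, h2]
    congr 2
    congr 1
    ext r
    simp [baseMap]

theorem autMapHom_isThetaHom (D : Extension θ R) {L L' : Type*} [CommRing L] [Algebra K L]
    [CommRing L'] [Algebra K L'] (φ : L →ₐ[K] L') (σ : autGroup D L) :
    (D.triv L').IsThetaHom (D.triv L')
      (autMapHom φ (σ.1 : R ⊗[K] L →ₐ[F] R ⊗[K] L)) := by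
  intro x
  induction x using TensorProduct.induction_on with
  | zero => simp
  | add x₁ x₂ h₁ h₂ => simp only [map_add, h₁, h₂]
  | tmul r a =>
    have hc : ∀ a : L', (D.triv L').toAlgHom (1 ⊗ₜ a) =
        PowerSeries.C (algebraMap (R ⊗[K] L') ((R ⊗[K] L') ⊗[F] B) (1 ⊗ₜ a)) := fun a => by
      change D.trivHom L' _ = _
      rw [Extension.trivHom_tmul]
      simp
    have hl : ∀ r : R, (r ⊗ₜ[K] (1 : L')) = baseMap F R φ (r ⊗ₜ 1) := fun r => by
      simp [baseMap]
    have h : r ⊗ₜ[K] a = (r ⊗ₜ 1) * ((1 : R) ⊗ₜ a) := by simp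
    have h1 : autMapHom φ (σ.1 : R ⊗[K] L →ₐ[F] R ⊗[K] L) ((1 : R) ⊗ₜ a) = 1 ⊗ₜ a := by
      rw [autMapHom_tmul, ← Algebra.TensorProduct.one_def, map_one, map_one, one_mul]
    have h2 := σ.2.1 (r ⊗ₜ 1)
    rw [AlgEquiv.coe_toAlgHom] at h2
    have h3 : (autMapHom φ (σ.1 : R ⊗[K] L →ₐ[F] R ⊗[K] L)).comp (baseMap F R φ) =
        (baseMap F R φ).comp (σ.1 : R ⊗[K] L →ₐ[F] R ⊗[K] L) :=
      AlgHom.ext fun x => autMapHom_baseMap D φ σ x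
    rw [h, map_mul, map_mul, map_mul, map_mul, h1, hc, mapCga_C, h1, hl, autMapHom_baseMap,
      triv_baseMap, triv_baseMap, h2, mapCga_comp_apply, mapCga_comp_apply, h3]

/-- The homomorphism `Aut^θ(R_L / F_L) → Aut^θ(R_{L'} / F_{L'})` given by base change along
`φ : L → L'`. -/
def autMap (D : Extension θ R) {L L' : Type*} [CommRing L] [Algebra K L]
    [CommRing L'] [Algebra K L'] (φ : L →ₐ[K] L') : autGroup D L →* autGroup D L' where
  toFun σ := ⟨AlgEquiv.ofAlgHom (autMapHom φ (σ.1 : R ⊗[K] L →ₐ[F] R ⊗[K] L))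
      (autMapHom φ ((σ⁻¹).1 : R ⊗[K] L →ₐ[F] R ⊗[K] L))
      (AlgHom.ext fun x => by
        rw [AlgHom.comp_apply, autMapHom_comp, mul_inv_cancel, autMapHom_one]; rfl)
      (AlgHom.ext fun x => by
        rw [AlgHom.comp_apply, autMapHom_comp, inv_mul_cancel, autMapHom_one]; rfl), by
    refine ⟨autMapHom_isThetaHom D φ σ, ?_⟩
    rintro _ ⟨y, rfl⟩
    change autMapHom φ (σ.1 : R ⊗[K] L →ₐ[F] R ⊗[K] L) _ = _
    induction y using TensorProduct.induction_on with
    | zero => simp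
    | add x₁ x₂ h₁ h₂ => simp only [map_add] at h₁ h₂ ⊢; rw [h₁, h₂]
    | tmul c a =>
      have h : (Algebra.TensorProduct.map (Algebra.ofId F R) (AlgHom.id K L') :
          F ⊗[K] L' →ₐ[F] R ⊗[K] L') (c ⊗ₜ a) = algebraMap F R c ⊗ₜ a := by
        simp [Algebra.ofId_apply]
      have h2 : (algebraMap F R c) ⊗ₜ[K] (1 : L) = algebraMap F (R ⊗[K] L) c := rfl
      have h3 : algebraMap F (R ⊗[K] L') c = (algebraMap F R c) ⊗ₜ[K] (1 : L') := rfl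
      change autMapHom φ _ ((Algebra.TensorProduct.map (Algebra.ofId F R) (AlgHom.id K L') :
          F ⊗[K] L' →ₐ[F] R ⊗[K] L') (c ⊗ₜ a)) =
          (Algebra.TensorProduct.map (Algebra.ofId F R) (AlgHom.id K L') :
          F ⊗[K] L' →ₐ[F] R ⊗[K] L') (c ⊗ₜ a)
      rw [h, autMapHom_tmul, h2, AlgHom.commutes, AlgHom.commutes, h3]
      simp⟩
  map_one' := Subtype.ext <| AlgEquiv.ext fun x => autMapHom_one D φ x
  map_mul' σ τ := Subtype.ext <| AlgEquiv.ext fun x => (autMapHom_comp D φ σ τ x).symm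

/-- The group functor `L ↦ Aut^θ(R_L / F_L)` on the category of `K`-algebras. -/
def autFunctor {θ : HigherDerivation K 𝒜} {R : Type u} [CommRing R] [Algebra F R] [Algebra K R]
    [IsScalarTower K F R] (D : Extension θ R) : CommAlgCat.{u} K ⥤ GrpCat.{u} where
  obj L := GrpCat.of (autGroup D L)
  map φ := GrpCat.ofHom (autMap D φ.hom)
  map_id L := by
    ext σ x
    change autMapHom (AlgHom.id K L) (σ.1 : R ⊗[K] L →ₐ[F] R ⊗[K] L) x = σ.1 x
    have h := autMapHom_baseMap D (AlgHom.id K L) σ x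
    have hid : ∀ y : R ⊗[K] L, baseMap F R (AlgHom.id K L) y = y := fun y => by
      simp [baseMap]
    rwa [hid, hid] at h
  map_comp {L L' L''} φ ψ := by
    ext σ x
    change autMapHom (ψ.hom.comp φ.hom) (σ.1 : R ⊗[K] L →ₐ[F] R ⊗[K] L) x =
      autMapHom ψ.hom (((autMap D φ.hom σ).1 : R ⊗[K] L' ≃ₐ[F] R ⊗[K] L') :
        R ⊗[K] L' →ₐ[F] R ⊗[K] L') x
    induction x using TensorProduct.induction_on with
    | zero => simp
    | add x₁ x₂ h₁ h₂ => simp only [map_add, h₁, h₂]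
    | tmul r a =>
      rw [autMapHom_tmul, autMapHom_tmul]
      change _ = baseMap F R ψ.hom (autMapHom φ.hom (σ.1 : R ⊗[K] L →ₐ[F] R ⊗[K] L) (r ⊗ₜ 1)) * _
      rw [autMapHom_tmul, ← Algebra.TensorProduct.one_def, mul_one, baseMap_baseMap]

/-- Restriction of scalars along `K → F`. For a group functor `𝒢` on `K`-algebras, the base change
`𝒢_F` is `restrict K F ⋙ 𝒢`. -/
def restrict (K F : Type*) [Field K] [Field F] [Algebra K F] :
    CommAlgCat.{u} F ⥤ CommAlgCat.{u} K where
  obj S := @CommAlgCat.of K _ S _ (Algebra.compHom S (algebraMap K F))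
  map {S S'} φ :=
    letI : Algebra K S := Algebra.compHom S (algebraMap K F)
    letI : Algebra K S' := Algebra.compHom S' (algebraMap K F)
    CommAlgCat.ofHom
      { φ.hom with commutes' := fun c => φ.hom.commutes (algebraMap K F c) }

/-- A right action of a group functor `𝒢` on a set-valued functor `X`. -/
structure RightAction {C : Type*} [Category C] (X : C ⥤ Type u) (𝒢 : C ⥤ GrpCat.{u}) where
  act : ∀ S : C, X.obj S → 𝒢.obj S → X.obj S
  act_one : ∀ (S : C) (x : X.obj S), act S x 1 = x
  act_mul : ∀ (S : C) (x : X.obj S) (g h : 𝒢.obj S), act S x (g * h) = act S (act S x g) h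
  act_map : ∀ {S S' : C} (φ : S ⟶ S') (x : X.obj S) (g : 𝒢.obj S),
    act S' (X.map φ x) (𝒢.map φ g) = X.map φ (act S x g)

/-- For an affine group scheme `𝒢` over `F` and an `F`-algebra `R`, both given by their functors of
points, `Spec R` is a `𝒢`-torsor (with respect to the given right action) if it is faithfully flat
and of finite presentation over `F` and if `(x, g) ↦ (x, x g)` is an isomorphism
`Spec R × 𝒢 → Spec R × Spec R`. -/
structure IsTorsor {F : Type*} [Field F] {R : Type u} [CommRing R] [Algebra F R]
    {𝒢 : CommAlgCat.{u} F ⥤ GrpCat.{u}}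
    (ρ : RightAction (coyoneda.obj (Opposite.op (CommAlgCat.of F R))) 𝒢) : Prop where
  faithfullyFlat : Module.FaithfullyFlat F R
  finitePresentation : Algebra.FinitePresentation F R
  bijective : ∀ S : CommAlgCat.{u} F, Function.Bijective
    fun p : (CommAlgCat.of F R ⟶ S) × 𝒢.obj S => (p.1, ρ.act S p.1 p.2)

/-- For an `S`-valued point `x : R → S` of `Spec R` over `F`, its `S`-linear extension
`R ⊗_K S → S`. -/
def pointExt {S : Type*} [CommRing S] [Algebra F S] [Algebra K S] [IsScalarTower K F S]
    (x : R →ₐ[F] S) : R ⊗[K] S →ₐ[F] S :=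
  Algebra.TensorProduct.lift x (AlgHom.id K S) (fun _ _ => Commute.all _ _)

/-- For an `S`-valued point `x : R → S` of `Spec R` over `F` and `g ∈ Aut^θ(R_S / F_S)`, the point
`x g` is the composite `R → R_S → R_S → S` of the inclusion, `g`, and the `S`-linear extension
of `x`. -/
def pointAct (D : Extension θ R) {S : Type*} [CommRing S] [Algebra F S] [Algebra K S]
    [IsScalarTower K F S] (x : R →ₐ[F] S) (g : autGroup D S) : R →ₐ[F] S :=
  (pointExt (K := K) x).comp ((g.1 : R ⊗[K] S →ₐ[F] R ⊗[K] S).comp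
    (Algebra.TensorProduct.includeLeft : R →ₐ[F] R ⊗[K] S))

theorem pointAct_apply (D : Extension θ R) {S : Type*} [CommRing S] [Algebra F S] [Algebra K S]
    [IsScalarTower K F S] (x : R →ₐ[F] S) (g : autGroup D S) (r : R) :
    pointAct D x g r = pointExt x (g.1 (r ⊗ₜ[K] (1 : S))) := rfl

theorem pointExt_pointAct (D : Extension θ R) {S : Type*} [CommRing S] [Algebra F S]
    [Algebra K S] [IsScalarTower K F S] (x : R →ₐ[F] S) (g : autGroup D S) (y : R ⊗[K] S) :
    pointExt (pointAct D x g) y = pointExt x (g.1 y) := by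
  induction y using TensorProduct.induction_on with
  | zero => simp
  | add x₁ x₂ h₁ h₂ => simp only [map_add, h₁, h₂]
  | tmul r a =>
    have h : r ⊗ₜ[K] a = (r ⊗ₜ 1) * ((1 : R) ⊗ₜ a) := by simp
    rw [h, map_mul, map_mul, map_mul, autGroup_apply_right, ← pointAct_apply]
    simp [pointExt]

theorem pointExt_map {S S' : Type*} [CommRing S] [Algebra F S] [Algebra K S]
    [IsScalarTower K F S] [CommRing S'] [Algebra F S'] [Algebra K S'] [IsScalarTower K F S']
    (φ : S →ₐ[F] S') (ψ : S →ₐ[K] S') (h : ∀ s, ψ s = φ s) (x : R →ₐ[F] S) (y : R ⊗[K] S) :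
    pointExt (φ.comp x) (baseMap F R ψ y) = φ (pointExt x y) := by
  induction y using TensorProduct.induction_on with
  | zero => simp
  | add x₁ x₂ h₁ h₂ => simp only [map_add, h₁, h₂]
  | tmul r a => simp [pointExt, baseMap, h]

theorem pointAct_map (D : Extension θ R) {S S' : Type*} [CommRing S] [Algebra F S] [Algebra K S]
    [IsScalarTower K F S] [CommRing S'] [Algebra F S'] [Algebra K S'] [IsScalarTower K F S']
    (φ : S →ₐ[F] S') (ψ : S →ₐ[K] S') (h : ∀ s, ψ s = φ s) (x : R →ₐ[F] S) (g : autGroup D S) :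
    pointAct D (φ.comp x) (autMap D ψ g) = φ.comp (pointAct D x g) := by
  ext r
  rw [AlgHom.comp_apply, pointAct_apply, pointAct_apply]
  change pointExt _ (autMapHom ψ (g.1 : R ⊗[K] S →ₐ[F] R ⊗[K] S) (r ⊗ₜ 1)) = _
  rw [autMapHom_tmul, ← Algebra.TensorProduct.one_def, mul_one, pointExt_map φ ψ h]
  rfl

/-- The right action of `𝒢_F` on `Spec R`, where `𝒢 = Aut^θ(R / F)`. -/
def pointAction {θ : HigherDerivation K 𝒜} {R : Type u} [CommRing R] [Algebra F R] [Algebra K R]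
    [IsScalarTower K F R] (D : Extension θ R) :
    RightAction (coyoneda.obj (Opposite.op (CommAlgCat.of F R)))
      (restrict K F ⋙ autFunctor D) where
  act S x g :=
    letI : Algebra K S := Algebra.compHom S (algebraMap K F)
    haveI : IsScalarTower K F S := IsScalarTower.of_algebraMap_eq fun _ => rfl
    CommAlgCat.ofHom (pointAct (S := S) D (CommAlgCat.Hom.hom x) g)
  act_one S x := by
    let _ : Algebra K S := Algebra.compHom S (algebraMap K F)
    have _ : IsScalarTower K F S := IsScalarTower.of_algebraMap_eq fun _ => rfl
    refine CommAlgCat.hom_ext (AlgHom.ext fun r => ?_)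
    change pointExt (K := K) (CommAlgCat.Hom.hom x) (r ⊗ₜ (1 : S)) = CommAlgCat.Hom.hom x r
    simp [pointExt]
  act_mul S x g h := by
    let _ : Algebra K S := Algebra.compHom S (algebraMap K F)
    have _ : IsScalarTower K F S := IsScalarTower.of_algebraMap_eq fun _ => rfl
    refine CommAlgCat.hom_ext (AlgHom.ext fun r => ?_)
    let h' : autGroup D S := h
    let g' : autGroup D S := g
    have key := pointExt_pointAct D (CommAlgCat.Hom.hom x) g' (h'.1 (r ⊗ₜ (1 : S)))
    exact key.symm
  act_map {S S'} φ x g := by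
    let _ : Algebra K S := Algebra.compHom S (algebraMap K F)
    have _ : IsScalarTower K F S := IsScalarTower.of_algebraMap_eq fun _ => rfl
    let _ : Algebra K S' := Algebra.compHom S' (algebraMap K F)
    have _ : IsScalarTower K F S' := IsScalarTower.of_algebraMap_eq fun _ => rfl
    exact CommAlgCat.hom_ext (pointAct_map (S := S) (S' := S') D φ.hom
      { φ.hom with commutes' := fun c => φ.hom.commutes (algebraMap K F c) } (fun _ => rfl)
      (CommAlgCat.Hom.hom x) g)

end Functor

end Theta

end

end PPV

namespace PPV

noncomputable section

universe u

/-! ### Stable ideals in a scalar extension -/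

section StableIdeals

variable {ι K R : Type*} [Field K] [CommRing R] [Algebra K R] (T : ι → R →ₗ[K] R)
  (L : Type*) [CommRing L] [Algebra K L]

/-! The crux is an isomorphism `R ⊗[K] U ≃ R ⊗[F] R` that is the first inclusion on `R` and the
given inclusion on the constants `U`.

It is injective because of a descent principle. For a `θ`-simple ring with constants `K`, an ideal
of `R ⊗[K] L` stable under the operators induced by `θ` vanishes as soon as it meets `1 ⊗ L` in zero
(`eq_bot_of_rTensor_stable`, a minimal support argument). Hence a `θ`-homomorphism out of `R ⊗[K] L`
is injective if it is injective on `L`.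

It is surjective because two images of one fundamental matrix differ by a matrix of constants
(`inv_mul_mem_constants`). Thus constants and one image of `R` generate every other image of `R`.

The rest is formal. Finite generation of `U` over `K` descends from that of `R ⊗[F] R` over `R`,
because `R` is faithfully flat over the field `K`. A homomorphism `U → L` specialises the second
inclusion `R → R ⊗[F] R ≃ R ⊗[K] U` to a `θ`-homomorphism `R → R ⊗[K] L`, which extends `L`-linearly
to an automorphism. Conversely, an automorphism `σ` gives `r ⊗ s ↦ r σ(s)` on `R ⊗[F] R`, and this
carries the constants `U` to the constants `L`. Finally, maps `R ⊗[F] R → S` are pairs of points of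
`Spec R`, while maps `R ⊗[K] U → S` are pairs of a point and a group element, so the isomorphism is
the torsor condition. -/

theorem basis_repr_rTensor {σ : Type*} (b : Module.Basis σ K L) (f : R →ₗ[K] R) (x : R ⊗[K] L)
    (s : σ) : (Algebra.TensorProduct.basis R b).repr (f.rTensor L x) s =
      f ((Algebra.TensorProduct.basis R b).repr x s) := by
  induction x using TensorProduct.induction_on with
  | zero => simp
  | add x₁ x₂ h₁ h₂ => simp only [map_add, Finsupp.add_apply, h₁, h₂]
  | tmul r a =>
    simp only [LinearMap.rTensor_tmul, Algebra.TensorProduct.basis_repr_tmul, Finsupp.smul_apply,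
      Finsupp.mapRange_apply, smul_eq_mul, mul_comm _ (algebraMap K R _), ← Algebra.smul_def,
      map_smul]

/-- In the `R`-basis of `R ⊗[K] L` induced by a `K`-basis of `L`, the operators act coefficient by
coefficient. So every coefficient is killed by all `T i`, lies in `K`, and can be moved across the
tensor sign. -/
theorem mem_range_includeRight_of_rTensor_eq_zero
    (hconst : ∀ r, (∀ i, T i r = 0) → r ∈ (⊥ : Subalgebra K R)) {x : R ⊗[K] L}
    (hx : ∀ i, (T i).rTensor L x = 0) :
    ∃ a : L, (1 : R) ⊗ₜ[K] a = x := by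
  let b := Module.Free.chooseBasis K L
  let b' := Algebra.TensorProduct.basis R b
  have h : ∀ s, ∃ c : K, algebraMap K R c = b'.repr x s := fun s => by
    refine Algebra.mem_bot.1 (hconst _ fun i => ?_)
    rw [← basis_repr_rTensor L b, hx]
    simp
  choose c hc using h
  refine ⟨∑ s ∈ (b'.repr x).support, c s • b s, ?_⟩
  conv_rhs => rw [← b'.linearCombination_repr x, Finsupp.linearCombination_apply, Finsupp.sum]
  rw [TensorProduct.tmul_sum]
  refine Finset.sum_congr rfl fun s _ => ?_
  rw [← hc, Algebra.TensorProduct.basis_apply, ← TensorProduct.smul_tmul, TensorProduct.smul_tmul',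
    smul_eq_mul, mul_one, Algebra.smul_def, mul_one]

/-- Take a nonzero element of `I` of minimal support with respect to a basis of `L`. By simplicity
one coefficient can be normalised to `1`. Every operator kills this coefficient, hence shortens the
element, hence annihilates it. The element is then constant, so it lies in `1 ⊗ L` and must vanish.
-/
theorem eq_bot_of_rTensor_stable [Nontrivial R] (hone : ∀ i, T i 1 = 0)
    (hsimple : ∀ I : Ideal R, (∀ i, ∀ r ∈ I, T i r ∈ I) → I = ⊥ ∨ I = ⊤)
    (hconst : ∀ r, (∀ i, T i r = 0) → r ∈ (⊥ : Subalgebra K R))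
    (I : Ideal (R ⊗[K] L)) (hI : ∀ i, ∀ x ∈ I, (T i).rTensor L x ∈ I)
    (hL : ∀ a : L, (1 : R) ⊗ₜ[K] a ∈ I → a = 0) : I = ⊥ := by
  by_contra hne
  let b := Module.Free.chooseBasis K L
  let b' := Algebra.TensorProduct.basis R b
  obtain ⟨x, ⟨hxI, hx0⟩, hmin⟩ := WellFounded.has_min
    (InvImage.wf (fun x : R ⊗[K] L => (b'.repr x).support.card) wellFounded_lt)
    {x | x ∈ I ∧ x ≠ 0} (Submodule.exists_mem_ne_zero_of_ne_bot hne)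
  obtain ⟨s, hs⟩ : (b'.repr x).support.Nonempty := by
    rw [Finsupp.support_nonempty_iff]
    simpa using hx0
  -- The coefficients at `s` of those elements of `I` supported inside the support of `x`. This
  -- ideal is stable because operators do not enlarge supports, and it is nonzero because of `x`.
  let Q : Ideal R :=
    { carrier := {r | ∃ y ∈ I, (b'.repr y).support ⊆ (b'.repr x).support ∧ b'.repr y s = r}
      add_mem' := by
        classical
        rintro _ _ ⟨y, hy, hys, rfl⟩ ⟨z, hz, hzs, rfl⟩
        refine ⟨y + z, I.add_mem hy hz, ?_, by simp⟩
        rw [map_add]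
        exact Finsupp.support_add.trans (Finset.union_subset hys hzs)
      zero_mem' := ⟨0, I.zero_mem, by simp, by simp⟩
      smul_mem' := by
        rintro c _ ⟨y, hy, hys, rfl⟩
        refine ⟨c • y, Submodule.smul_of_tower_mem I c hy, ?_, by simp⟩
        rw [map_smul]
        exact Finsupp.support_smul.trans hys }
  have hsupp : ∀ i y, (b'.repr ((T i).rTensor L y)).support ⊆ (b'.repr y).support := by
    intro i y t ht
    rw [Finsupp.mem_support_iff] at ht ⊢
    intro h0
    apply ht
    rw [basis_repr_rTensor L b, h0, map_zero]
  have hQ : Q = ⊤ := by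
    refine (hsimple Q ?_).resolve_left fun h => ?_
    · rintro i _ ⟨y, hy, hys, rfl⟩
      exact ⟨_, hI i y hy, (hsupp i y).trans hys, basis_repr_rTensor L b _ _ _⟩
    · have : b'.repr x s ∈ Q := ⟨x, hxI, subset_rfl, rfl⟩
      rw [h, Ideal.mem_bot] at this
      exact Finsupp.mem_support_iff.1 hs this
  obtain ⟨y, hyI, hys, hy1⟩ : (1 : R) ∈ Q := hQ ▸ Submodule.mem_top
  -- Applying `T i` turns the coefficient `1` at `s` into `0`, so the support becomes strictly
  -- smaller than that of `x`; minimality leaves only zero.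
  have hconst_y : ∀ i, (T i).rTensor L y = 0 := by
    intro i
    by_contra h0
    refine hmin _ ⟨hI i y hyI, h0⟩ (Finset.card_lt_card ?_)
    refine Finset.ssubset_of_subset_of_ssubset (Finset.subset_erase.2 ⟨(hsupp i y).trans hys, ?_⟩)
      (Finset.erase_ssubset hs)
    rw [Finsupp.mem_support_iff, not_not, basis_repr_rTensor L b, hy1, hone]
  obtain ⟨a, rfl⟩ := mem_range_includeRight_of_rTensor_eq_zero T L hconst hconst_y
  rw [hL a hyI, TensorProduct.tmul_zero, map_zero, Finsupp.zero_apply] at hy1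
  exact zero_ne_one hy1

end StableIdeals

/-! ### Components of a higher derivation -/

section Contract

variable {F B : Type*} [Field F] [CommRing B] [Algebra F B]
  {R : Type*} [CommRing R] [Algebra F R]

/-- The map `id ⊗ φ : R ⊗ B → R` for a linear form `φ` on `B`. -/
def contract (R : Type*) [CommRing R] [Algebra F R] (φ : B →ₗ[F] F) : R ⊗[F] B →ₗ[R] R :=
  (TensorProduct.AlgebraTensorModule.rid F R R).toLinearMap ∘ₗ φ.baseChange R

@[simp]
theorem contract_tmul (φ : B →ₗ[F] F) (r : R) (b : B) : contract R φ (r ⊗ₜ b) = φ b • r := by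
  simp [contract]

theorem contract_map {R' : Type*} [CommRing R'] [Algebra F R'] (φ : B →ₗ[F] F) (f : R →ₐ[F] R')
    (y : R ⊗[F] B) :
    contract R' φ (Algebra.TensorProduct.map f (AlgHom.id F B) y) = f (contract R φ y) := by
  induction y using TensorProduct.induction_on with
  | zero => simp
  | add x₁ x₂ h₁ h₂ => simp only [map_add, h₁, h₂]
  | tmul r a => simp

/-- The coordinate forms of an `F`-basis of `B` already recover all coordinates of `y`. -/
theorem eq_zero_of_contract_eq_zero {y : R ⊗[F] B} (h : ∀ φ : B →ₗ[F] F, contract R φ y = 0) :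
    y = 0 := by
  let b := Module.Free.chooseBasis F B
  refine (Algebra.TensorProduct.basis R b).repr.injective (Finsupp.ext fun s => ?_)
  rw [map_zero, Finsupp.zero_apply, ← h (b.coord s)]
  clear h
  induction y using TensorProduct.induction_on with
  | zero => simp
  | add x₁ x₂ h₁ h₂ => simp only [map_add, Finsupp.add_apply, h₁, h₂]
  | tmul r a => simp [Algebra.TensorProduct.basis_repr_tmul, Algebra.smul_def, mul_comm]

/-- An `F`-linear retraction of `B` onto `N` allows `y` to be expanded in a basis of `N`. Its
coordinates are contractions against forms on all of `B`, hence lie in `I`. This turns the condition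
defining `θ`-ideals into stability under scalar operators. -/
theorem mem_range_map_of_contract_mem {N : Submodule F B} {I : Ideal R} {y : R ⊗[F] B}
    (hy : y ∈ N.baseChange R) (h : ∀ φ : B →ₗ[F] F, contract R φ y ∈ I) :
    y ∈ LinearMap.range (TensorProduct.map (I.restrictScalars F).subtype N.subtype) := by
  obtain ⟨p, hp⟩ := LinearMap.exists_leftInverse_of_injective N.subtype (Submodule.ker_subtype N)
  have hpy : N.subtype.baseChange R (p.baseChange R y) = y := by
    rw [Submodule.baseChange_eq_span] at hy
    refine Submodule.span_induction ?_ ?_ ?_ ?_ hy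
    · rintro _ ⟨b, hb, rfl⟩
      have : p b = ⟨b, hb⟩ := LinearMap.congr_fun hp ⟨b, hb⟩
      simp [this]
    · simp
    · intro a b _ _ ha hb
      rw [map_add, map_add, ha, hb]
    · intro r a _ ha
      rw [map_smul, map_smul, ha]
  let b := Module.Free.chooseBasis F N
  let b' := Algebra.TensorProduct.basis R b
  have hrepr : ∀ s, b'.repr (p.baseChange R y) s = contract R (b.coord s ∘ₗ p) y := by
    intro s
    clear hpy h hy
    induction y using TensorProduct.induction_on with
    | zero => simp
    | add x₁ x₂ h₁ h₂ => simp only [map_add, Finsupp.add_apply, h₁, h₂]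
    | tmul r a => simp [b', Algebra.TensorProduct.basis_repr_tmul, Algebra.smul_def, mul_comm]
  rw [← hpy, ← b'.linearCombination_repr (p.baseChange R y), Finsupp.linearCombination_apply,
    Finsupp.sum, map_sum]
  refine Submodule.sum_mem _ fun s _ => ⟨(⟨b'.repr (p.baseChange R y) s, ?_⟩ :
    I.restrictScalars F) ⊗ₜ b s, ?_⟩
  · rw [hrepr]
    exact h _
  · simp [b', TensorProduct.smul_tmul']

end Contract

/-! ### Scalar operators that detect constants and `θ`-ideals -/

namespace Extension

variable {K F B : Type*} [Field K] [Field F] [Algebra K F] [CommRing B] [Algebra F B]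
  [Algebra K B] [IsScalarTower K F B] {𝒜 : ℕ → Submodule F B} [GradedAlgebra 𝒜]
  {θ : HigherDerivation K 𝒜}
  {R : Type*} [CommRing R] [Algebra F R] [Algebra K R] [IsScalarTower K F R]
  {R' : Type*} [CommRing R'] [Algebra F R'] [Algebra K R'] [IsScalarTower K F R']

/-- The operator `(id ⊗ φ) ∘ θ⁽ᵏ⁾` on `R`. -/
def op (D : Extension θ R) (k : ℕ) (φ : B →ₗ[F] F) : R →ₗ[K] R where
  toFun r := contract R φ (PowerSeries.coeff k (D.toAlgHom r))
  map_add' r s := by rw [map_add, map_add, map_add]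
  map_smul' c r := by
    have h : PowerSeries.coeff k (c • D.toAlgHom r) = c • PowerSeries.coeff k (D.toAlgHom r) := rfl
    rw [map_smul, h, LinearMap.map_smul_of_tower, RingHom.id_apply]

theorem op_apply (D : Extension θ R) (k : ℕ) (φ : B →ₗ[F] F) (r : R) :
    D.op k φ r = contract R φ (PowerSeries.coeff k (D.toAlgHom r)) := rfl

/-- Degree `0` of `θ` is always the identity, so only the positive degrees matter; this is the
reason for the shift `i.1 + 1`, which also makes all the operators kill `1`. -/
theorem mem_constants_iff (D : Extension θ R) (r : R) :
    r ∈ D.toHigherDerivation.constants ↔ ∀ i : ℕ × (B →ₗ[F] F), D.op (i.1 + 1) i.2 r = 0 := by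
  constructor
  · intro h i
    have h' : D.toAlgHom r = PowerSeries.C (algebraMap R (R ⊗[F] B) r) := h
    rw [op_apply, h', PowerSeries.coeff_C, if_neg (Nat.succ_ne_zero _), map_zero]
  · intro h
    change D.toAlgHom r = PowerSeries.C (algebraMap R (R ⊗[F] B) r)
    ext k
    rw [PowerSeries.coeff_C]
    cases k with
    | zero => rw [if_pos rfl, D.coeff_zero]
    | succ k =>
      rw [if_neg (Nat.succ_ne_zero _)]
      exact eq_zero_of_contract_eq_zero fun φ => h (k, φ)

theorem op_succ_one (D : Extension θ R) (i : ℕ × (B →ₗ[F] F)) : D.op (i.1 + 1) i.2 1 = 0 :=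
  (D.mem_constants_iff 1).1 (Subalgebra.one_mem _) i

/-- Operators of degree `0` are multiplications by scalars `φ 1`, which preserve every ideal, so
stability in positive degrees suffices. -/
theorem IsThetaSimple.eq_bot_or_eq_top_of_stable {D : Extension θ R} (hD : D.IsThetaSimple)
    (I : Ideal R) (hI : ∀ i : ℕ × (B →ₗ[F] F), ∀ r ∈ I, D.op (i.1 + 1) i.2 r ∈ I) :
    I = ⊥ ∨ I = ⊤ := by
  refine hD.2 I fun k r hr => mem_range_map_of_contract_mem (D.coeff_mem k r) fun φ => ?_
  cases k with
  | zero =>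
    rw [D.coeff_zero, Algebra.TensorProduct.algebraMap_apply, contract_tmul]
    exact Submodule.smul_of_tower_mem I _ hr
  | succ k => exact hI (k, φ) r hr

theorem IsThetaHom.map_op {D : Extension θ R} {D' : Extension θ R'} {f : R →ₐ[F] R'}
    (hf : D.IsThetaHom D' f) (k : ℕ) (φ : B →ₗ[F] F) (r : R) :
    f (D.op k φ r) = D'.op k φ (f r) := by
  rw [op_apply, op_apply, hf, ← contract_map]
  rfl

theorem IsThetaHom.map_constants {D : Extension θ R} {D' : Extension θ R'} {f : R →ₐ[F] R'}
    (hf : D.IsThetaHom D' f) {r : R} (hr : r ∈ D.toHigherDerivation.constants) :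
    f r ∈ D'.toHigherDerivation.constants := by
  rw [mem_constants_iff] at hr ⊢
  intro i
  rw [← hf.map_op, hr, map_zero]

/-- Identifies the operators of a trivial extension with the coefficientwise ones for which the
stable ideal argument was made. -/
theorem op_triv (D : Extension θ R) (L : Type*) [CommRing L] [Algebra K L] (k : ℕ)
    (φ : B →ₗ[F] F) (x : R ⊗[K] L) : (D.triv L).op k φ x = (D.op k φ).rTensor L x := by
  induction x using TensorProduct.induction_on with
  | zero => simp
  | add x₁ x₂ h₁ h₂ => simp only [map_add, h₁, h₂]
  | tmul r a =>
    rw [LinearMap.rTensor_tmul, op_apply]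
    change contract _ φ (PowerSeries.coeff k (D.trivHom L (r ⊗ₜ a))) = _
    rw [trivHom_tmul, PowerSeries.coeff_mul_C, mul_comm, ← Algebra.smul_def, map_smul]
    simp only [mapCga, PowerSeries.coeff_map, AlgHom.toRingHom_eq_coe, RingHom.coe_coe]
    rw [contract_map, ← op_apply]
    simp

/-! ### Scalar extensions of a `θ`-simple ring -/

section Simple

variable {D : Extension θ R} (hD : D.IsThetaSimple) (hc : D.toHigherDerivation.constants = ⊥)
  (L : Type*) [CommRing L] [Algebra K L]

include hc in
theorem exists_of_mem_constants_triv {x : R ⊗[K] L}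
    (hx : x ∈ (D.triv L).toHigherDerivation.constants) : ∃ a : L, (1 : R) ⊗ₜ[K] a = x := by
  refine mem_range_includeRight_of_rTensor_eq_zero
    (fun i : ℕ × (B →ₗ[F] F) => D.op (i.1 + 1) i.2) L (fun r hr => ?_) fun i => ?_
  · rw [← hc]
    exact (D.mem_constants_iff r).2 hr
  · rw [← op_triv]
    exact ((D.triv L).mem_constants_iff x).1 hx i

include hD hc in
-- The kernel is stable under the operators, since `θ`-homomorphisms commute with them, and `hL`
-- says that it meets `1 ⊗ L` in zero.
theorem IsThetaHom.injective_of_triv {D' : Extension θ R'} {f : R ⊗[K] L →ₐ[F] R'}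
    (hf : (D.triv L).IsThetaHom D' f) (hL : ∀ a : L, f (1 ⊗ₜ[K] a) = 0 → a = 0) :
    Function.Injective f := by
  have := hD.1
  have h : RingHom.ker f = ⊥ := by
    refine eq_bot_of_rTensor_stable (fun i : ℕ × (B →ₗ[F] F) => D.op (i.1 + 1) i.2) L
      D.op_succ_one hD.eq_bot_or_eq_top_of_stable (fun r hr => ?_) _ (fun i x hx => ?_) hL
    · rw [← hc]
      exact (D.mem_constants_iff r).2 hr
    · rw [RingHom.mem_ker] at hx ⊢
      rw [← op_triv, hf.map_op, hx, map_zero]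
  exact (RingHom.injective_iff_ker_eq_bot _).2 h

end Simple

end Extension

namespace Extension

variable {K F B : Type*} [Field K] [Field F] [Algebra K F] [CommRing B] [Algebra F B]
  [Algebra K B] [IsScalarTower K F B] {𝒜 : ℕ → Submodule F B} [GradedAlgebra 𝒜]
  {θ : HigherDerivation K 𝒜}
  {R : Type*} [CommRing R] [Algebra F R] [Algebra K R] [IsScalarTower K F R]
  {R' : Type*} [CommRing R'] [Algebra F R'] [Algebra K R'] [IsScalarTower K F R']
  {R'' : Type*} [CommRing R''] [Algebra F R''] [Algebra K R''] [IsScalarTower K F R'']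

/-! ### Constructions of `θ`-homomorphisms -/

theorem IsThetaHom.comp {D : Extension θ R} {D' : Extension θ R'} {D'' : Extension θ R''}
    {g : R' →ₐ[F] R''} {f : R →ₐ[F] R'} (hg : D'.IsThetaHom D'' g) (hf : D.IsThetaHom D' f) :
    D.IsThetaHom D'' (g.comp f) := fun x => by
  rw [AlgHom.comp_apply, hg, hf, mapCga_comp_apply]

theorem IsThetaHom.symm {D : Extension θ R} {D' : Extension θ R'} {e : R ≃ₐ[F] R'}
    (he : D.IsThetaHom D' (e : R →ₐ[F] R')) : D'.IsThetaHom D (e.symm : R' →ₐ[F] R) := fun x => by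
  have h := he (e.symm x)
  have h1 : (e : R →ₐ[F] R') (e.symm x) = x := e.apply_symm_apply x
  have h2 : (e.symm : R' →ₐ[F] R).comp (e : R →ₐ[F] R') = AlgHom.id F R := by
    ext y
    exact e.symm_apply_apply y
  rw [h1] at h
  rw [h, mapCga_comp_apply, h2, mapCga_id_apply]
  rfl

theorem isThetaHom_includeLeft (D : Extension θ R) (D' : Extension θ R') :
    D.IsThetaHom (D.tensor D') Algebra.TensorProduct.includeLeft := fun x => by
  change tensorAddHom D D' (x ⊗ₜ 1) = _
  rw [tensorAddHom_tmul, map_one, map_one, mul_one]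

theorem isThetaHom_includeRight (D : Extension θ R) (D' : Extension θ R') :
    D'.IsThetaHom (D.tensor D') Algebra.TensorProduct.includeRight := fun x => by
  change tensorAddHom D D' (1 ⊗ₜ x) = _
  rw [tensorAddHom_tmul, map_one, map_one, one_mul]

theorem isThetaHom_includeLeft_triv (D : Extension θ R) (L : Type*) [CommRing L] [Algebra K L] :
    D.IsThetaHom (D.triv L) (Algebra.TensorProduct.includeLeft : R →ₐ[F] R ⊗[K] L) := fun x => by
  change D.trivHom L (x ⊗ₜ 1) = _
  rw [trivHom_tmul, ← Algebra.TensorProduct.one_def, map_one, map_one, mul_one]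

theorem isThetaHom_baseMap (D : Extension θ R) {L L' : Type*} [CommRing L] [Algebra K L]
    [CommRing L'] [Algebra K L'] (φ : L →ₐ[K] L') :
    (D.triv L).IsThetaHom (D.triv L') (baseMap F R φ) := triv_baseMap D φ

theorem IsThetaHom.productMap {D : Extension θ R} {D' : Extension θ R'} {D'' : Extension θ R''}
    {f : R →ₐ[F] R''} {g : R' →ₐ[F] R''} (hf : D.IsThetaHom D'' f) (hg : D'.IsThetaHom D'' g) :
    (D.tensor D').IsThetaHom D'' (Algebra.TensorProduct.productMap f g) := fun x => by
  change _ = mapCga B _ (tensorAddHom D D' x)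
  induction x using TensorProduct.induction_on with
  | zero => simp
  | add x₁ x₂ h₁ h₂ => simp only [map_add, h₁, h₂]
  | tmul r a =>
    rw [tensorAddHom_tmul, map_mul, mapCga_comp_apply, mapCga_comp_apply,
      Algebra.TensorProduct.productMap_left, Algebra.TensorProduct.productMap_right,
      Algebra.TensorProduct.productMap_apply_tmul, map_mul, hf, hg]

/-- The extension of `f : R → R'` to `R ⊗ L` by means of `c : L → R'`. -/
def liftConst {L : Type*} [CommRing L] [Algebra K L] (f : R →ₐ[F] R') (c : L →ₐ[K] R') :
    R ⊗[K] L →ₐ[F] R' :=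
  Algebra.TensorProduct.lift f c fun _ _ => Commute.all _ _

@[simp]
theorem liftConst_tmul {L : Type*} [CommRing L] [Algebra K L] (f : R →ₐ[F] R') (c : L →ₐ[K] R')
    (r : R) (a : L) : liftConst f c (r ⊗ₜ a) = f r * c a :=
  Algebra.TensorProduct.lift_tmul _ _ _ _ _

theorem IsThetaHom.liftConst {L : Type*} [CommRing L] [Algebra K L] {D : Extension θ R}
    {D' : Extension θ R'} {f : R →ₐ[F] R'} (hf : D.IsThetaHom D' f) {c : L →ₐ[K] R'}
    (hc : ∀ a, c a ∈ D'.toHigherDerivation.constants) :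
    (D.triv L).IsThetaHom D' (Extension.liftConst f c) := fun x => by
  change _ = mapCga B _ (D.trivHom L x)
  induction x using TensorProduct.induction_on with
  | zero => simp
  | add x₁ x₂ h₁ h₂ => simp only [map_add, h₁, h₂]
  | tmul r a =>
    have h : D'.toAlgHom (c a) = PowerSeries.C (algebraMap R' (R' ⊗[F] B) (c a)) := hc a
    have h' : (Extension.liftConst f c).comp
        (Algebra.TensorProduct.includeLeft : R →ₐ[F] R ⊗[K] L) = f := by
      ext r
      simp
    rw [trivHom_tmul, map_mul, mapCga_comp_apply, h', mapCga_C, liftConst_tmul, liftConst_tmul,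
      map_mul, hf, h, map_one, one_mul]

theorem tmul_mem_constants_triv (D : Extension θ R) {L : Type*} [CommRing L] [Algebra K L]
    (a : L) : (1 : R) ⊗ₜ[K] a ∈ (D.triv L).toHigherDerivation.constants := by
  change D.trivHom L (1 ⊗ₜ a) = _
  rw [trivHom_tmul, map_one, map_one, one_mul]

/-! ### Fundamental solution matrices -/

/-- Images of a fundamental solution matrix under two `θ`-homomorphisms differ by a matrix of
constants. -/
theorem inv_mul_mem_constants {D : Extension θ R} {D' : Extension θ R'} {n : ℕ}
    {A : Matrix (Fin n) (Fin n) (Cga 𝒜)} {Y : GL (Fin n) R}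
    (hY : Y.val.map D.toAlgHom =
      A.map (fun x => PowerSeries.map
        (Algebra.TensorProduct.includeRight : B →ₐ[F] R ⊗[F] B).toRingHom (x : B⟦X⟧)) *
      Y.val.map (fun y => PowerSeries.C (algebraMap R (R ⊗[F] B) y)))
    {f g : R →ₐ[F] R'} (hf : D.IsThetaHom D' f) (hg : D.IsThetaHom D' g) (i j : Fin n) :
    (Y⁻¹.val.map f * Y.val.map g) i j ∈ D'.toHigherDerivation.constants := by
  -- `ρ` is the higher derivation of `R'` and `γ` the embedding in degree `0`; constants are the
  -- elements on which they agree.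
  let ρ : R' →+* (R' ⊗[F] B)⟦X⟧ := D'.toAlgHom.toRingHom
  let γ : R' →+* (R' ⊗[F] B)⟦X⟧ := PowerSeries.C.comp (algebraMap R' (R' ⊗[F] B))
  let A' := A.map (fun x => PowerSeries.map
    (Algebra.TensorProduct.includeRight : B →ₐ[F] R' ⊗[F] B).toRingHom (x : B⟦X⟧))
  -- Every image of `Y` under a `θ`-homomorphism solves the same equation, because `A` has entries
  -- over `F`.
  have key : ∀ h : R →ₐ[F] R', D.IsThetaHom D' h →
      (Y.val.map h).map ρ = A' * (Y.val.map h).map γ := by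
    intro h hh
    have h1 : (Y.val.map h).map ρ = (Y.val.map D.toAlgHom).map (mapCga B h) := by
      ext1 a b
      exact hh _
    rw [h1, hY, Matrix.map_mul, Matrix.map_map, Matrix.map_map]
    congr 1
    · ext1 a b
      ext k
      simp [mapCga, A']
    · ext1 a b
      exact mapCga_C h _
  have hinv : Y⁻¹.val.map f * Y.val.map f = 1 := by
    rw [← Matrix.map_mul, ← Units.val_mul, inv_mul_cancel, Units.val_one,
      Matrix.map_one f (map_zero f) (map_one f)]
  have hinv' : Y.val.map f * Y⁻¹.val.map f = 1 := by
    rw [← Matrix.map_mul, ← Units.val_mul, mul_inv_cancel, Units.val_one,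
      Matrix.map_one f (map_zero f) (map_one f)]
  have hfZ : Y.val.map f * (Y⁻¹.val.map f * Y.val.map g) = Y.val.map g := by
    rw [← mul_assoc, hinv', one_mul]
  set Z := Y⁻¹.val.map f * Y.val.map g with hZ
  -- With `g(Y) = f(Y) Z`, the equation gives `θ(f(Y)) θ(Z) = A g(Y) = A f(Y) Z = θ(f(Y)) Z`; it
  -- remains to cancel the invertible matrix `θ(f(Y))`.
  have h2 : (Y.val.map f).map ρ * Z.map ρ = (Y.val.map f).map ρ * Z.map γ := by
    rw [← Matrix.map_mul, hfZ, key g hg, key f hf, mul_assoc, ← Matrix.map_mul, hfZ]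
  have h3 : Z.map ρ = Z.map γ := by
    have h4 : (Y⁻¹.val.map f).map ρ * (Y.val.map f).map ρ = 1 := by
      rw [← Matrix.map_mul, hinv, Matrix.map_one ρ (map_zero ρ) (map_one ρ)]
    rw [← one_mul (Z.map ρ), ← h4, mul_assoc, h2, ← mul_assoc, h4, one_mul]
  exact congrFun (congrFun h3 i) j

theorem mem_of_adjoin_fundamental {n : ℕ} {Y : GL (Fin n) R}
    (hY : Algebra.adjoin F
      ((Set.range fun p : Fin n × Fin n => Y.val p.1 p.2) ∪ {Y⁻¹.val.det}) = ⊤)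
    (g : R →ₐ[F] R') (P : Subalgebra F R') (h : ∀ i j, Y.val.map g i j ∈ P)
    (h' : ∀ i j, Y⁻¹.val.map g i j ∈ P) (r : R) : g r ∈ P := by
  have hle : Algebra.adjoin F
      ((Set.range fun p : Fin n × Fin n => Y.val p.1 p.2) ∪ {Y⁻¹.val.det}) ≤ P.comap g := by
    refine Algebra.adjoin_le ?_
    rintro _ (⟨p, rfl⟩ | hr)
    · exact h p.1 p.2
    · rw [Set.mem_singleton_iff.1 hr]
      change g _ ∈ P
      -- The last generator is `det (Y⁻¹)`, which by the Leibniz formula is a polynomial in the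
      -- entries of `Y⁻¹`.
      rw [Matrix.det_apply, map_sum]
      refine Subalgebra.sum_mem _ fun σ _ => ?_
      rw [Units.smul_def, map_zsmul, map_prod]
      exact Subalgebra.zsmul_mem _ (Subalgebra.prod_mem _ fun i _ => h' _ _) _
  rw [hY] at hle
  exact hle Algebra.mem_top

variable {D : Extension θ R}

theorem IsPPVRing.simple (hR : D.IsPPVRing) : D.IsThetaSimple := by
  obtain ⟨n, A, -, h⟩ := hR
  exact h.simple

theorem IsPPVRing.constants (hR : D.IsPPVRing) : D.toHigherDerivation.constants = ⊥ := by
  obtain ⟨n, A, -, h⟩ := hR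
  exact h.constants

theorem IsPPVRing.finiteType (hR : D.IsPPVRing) : Algebra.FiniteType F R := by
  obtain ⟨n, A, -, h⟩ := hR
  obtain ⟨Y, -, hY⟩ := h.fundamental
  refine ⟨(Subalgebra.fg_def).2 ⟨_, ?_, hY⟩⟩
  exact (Set.finite_range _).union (Set.finite_singleton _)

/-- A subalgebra that contains the constants and the image of one `θ`-homomorphism out of a
PPV-ring contains the images of all of them. -/
theorem IsPPVRing.mem_of_isThetaHom (hR : D.IsPPVRing) {D' : Extension θ R'} {f g : R →ₐ[F] R'}
    (hf : D.IsThetaHom D' f) (hg : D.IsThetaHom D' g) (P : Subalgebra F R')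
    (hfP : ∀ r, f r ∈ P) (hP : ∀ x ∈ D'.toHigherDerivation.constants, x ∈ P) (r : R) :
    g r ∈ P := by
  obtain ⟨n, A, -, h⟩ := hR
  obtain ⟨Y, hYA, hY⟩ := h.fundamental
  have hmul : ∀ (M N : Matrix (Fin n) (Fin n) R'), (∀ i j, M i j ∈ P) → (∀ i j, N i j ∈ P) →
      ∀ i j, (M * N) i j ∈ P := fun M N hM hN i j => by
    rw [Matrix.mul_apply]
    exact Subalgebra.sum_mem _ fun k _ => Subalgebra.mul_mem _ (hM _ _) (hN _ _)
  refine mem_of_adjoin_fundamental hY g P ?_ ?_ r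
  · have h1 : Y.val.map g = Y.val.map f * (Y⁻¹.val.map f * Y.val.map g) := by
      rw [← mul_assoc, ← Matrix.map_mul, ← Units.val_mul, mul_inv_cancel, Units.val_one,
        Matrix.map_one f (map_zero f) (map_one f), one_mul]
    rw [h1]
    exact hmul _ _ (fun i j => hfP _) fun i j => hP _ (inv_mul_mem_constants hYA hf hg i j)
  -- For the inverse matrix the roles of `f` and `g` are exchanged: `g(Y)⁻¹ = (g(Y)⁻¹ f(Y)) f(Y)⁻¹`,
  -- with a constant matrix in parentheses.
  · have h1 : Y⁻¹.val.map g = (Y⁻¹.val.map g * Y.val.map f) * Y⁻¹.val.map f := by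
      rw [mul_assoc, ← Matrix.map_mul (f := f), ← Units.val_mul, mul_inv_cancel, Units.val_one,
        Matrix.map_one f (map_zero f) (map_one f), mul_one]
    rw [h1]
    exact hmul _ _ (fun i j => hP _ (inv_mul_mem_constants hYA hg hf i j)) fun i j => hfP _

/-! ### The isomorphism `R ⊗_K U ≃ R ⊗_F R` -/

/-- Injectivity needs checking only on the constants, where the map is an inclusion. The range
contains the constants and the left copy of `R`, hence also the right copy. -/
theorem IsPPVRing.bijective_liftConst (hR : D.IsPPVRing) : Function.Bijective
    (liftConst (Algebra.TensorProduct.includeLeft : R →ₐ[F] R ⊗[F] R)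
      (D.tensor D).toHigherDerivation.constants.val) := by
  set μ := liftConst (Algebra.TensorProduct.includeLeft : R →ₐ[F] R ⊗[F] R)
      (D.tensor D).toHigherDerivation.constants.val with hμ
  have hθ : (D.triv _).IsThetaHom (D.tensor D) μ :=
    (isThetaHom_includeLeft D D).liftConst fun a => a.2
  refine ⟨hθ.injective_of_triv hR.simple hR.constants _ fun a ha => Subtype.ext ?_, fun x => ?_⟩
  · simpa [hμ, ← Algebra.TensorProduct.one_def] using ha
  · have hl : ∀ r : R, r ⊗ₜ[F] (1 : R) ∈ μ.range := fun r => ⟨r ⊗ₜ 1, by simp [hμ]⟩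
    have hr := hR.mem_of_isThetaHom (isThetaHom_includeLeft D D) (isThetaHom_includeRight D D)
      μ.range hl fun x hx => ⟨1 ⊗ₜ ⟨x, hx⟩, by simp [hμ, ← Algebra.TensorProduct.one_def]⟩
    change x ∈ μ.range
    induction x using TensorProduct.induction_on with
    | zero => exact Subalgebra.zero_mem _
    | add x₁ x₂ h₁ h₂ => exact Subalgebra.add_mem _ h₁ h₂
    | tmul r s =>
      have h : r ⊗ₜ[F] s = (r ⊗ₜ 1) * (1 ⊗ₜ s) := by simp
      rw [h]
      exact Subalgebra.mul_mem _ (hl r) (hr s)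

/-- For a PPV-ring `R` and `U = C_{R ⊗_F R}`, the isomorphism `R ⊗_K U ≃ R ⊗_F R`. -/
def IsPPVRing.constEquiv (hR : D.IsPPVRing) :
    R ⊗[K] (D.tensor D).toHigherDerivation.constants ≃ₐ[F] R ⊗[F] R :=
  AlgEquiv.ofBijective _ hR.bijective_liftConst

theorem IsPPVRing.constEquiv_tmul (hR : D.IsPPVRing) (r : R)
    (a : (D.tensor D).toHigherDerivation.constants) :
    hR.constEquiv (r ⊗ₜ a) = r ⊗ₜ 1 * (a : R ⊗[F] R) :=
  liftConst_tmul _ _ _ _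

theorem IsPPVRing.isThetaHom_constEquiv (hR : D.IsPPVRing) :
    (D.triv _).IsThetaHom (D.tensor D) hR.constEquiv.toAlgHom :=
  (isThetaHom_includeLeft D D).liftConst fun a => a.2

/-- After base change along the faithfully flat map `K → R`, the algebra of constants becomes `R
⊗[F] R`, which is of finite type; this property descends. -/
theorem IsPPVRing.finiteType_constants (hR : D.IsPPVRing) :
    Algebra.FiniteType K (D.tensor D).toHigherDerivation.constants := by
  have := hR.simple.1
  have := hR.finiteType
  have : Algebra.FiniteType F (R ⊗[F] R) := Algebra.FiniteType.trans ‹_› (S := R) inferInstance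
  have : Algebra.FiniteType F (R ⊗[K] (D.tensor D).toHigherDerivation.constants) :=
    this.equiv hR.constEquiv.symm
  have : Algebra.FiniteType R (R ⊗[K] (D.tensor D).toHigherDerivation.constants) :=
    Algebra.FiniteType.of_restrictScalars_finiteType F _ _
  exact Algebra.FiniteType.of_finiteType_tensorProduct_of_faithfullyFlat R

end Extension

namespace Extension

variable {K F B : Type*} [Field K] [Field F] [Algebra K F] [CommRing B] [Algebra F B]
  [Algebra K B] [IsScalarTower K F B] {𝒜 : ℕ → Submodule F B} [GradedAlgebra 𝒜]
  {θ : HigherDerivation K 𝒜}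
  {R : Type*} [CommRing R] [Algebra F R] [Algebra K R] [IsScalarTower K F R]
  {D : Extension θ R}

/-! ### Automorphisms attached to homomorphisms `U → L` -/

section AutOf

variable {L : Type*} [CommRing L] [Algebra K L]

/-- Elements of the group fix `1 ⊗ L`, so they are determined on `R ⊗ 1`. -/
theorem autGroup_ext {σ τ : autGroup D L}
    (h : ∀ r : R, σ.1 (r ⊗ₜ[K] (1 : L)) = τ.1 (r ⊗ₜ 1)) : σ = τ := by
  refine Subtype.ext (AlgEquiv.ext fun x => ?_)
  induction x using TensorProduct.induction_on with
  | zero => simp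
  | add x₁ x₂ h₁ h₂ => simp only [map_add, h₁, h₂]
  | tmul r a =>
    have h' : r ⊗ₜ[K] a = (r ⊗ₜ 1) * ((1 : R) ⊗ₜ a) := by simp
    rw [h', map_mul, map_mul, h, autGroup_apply_right, autGroup_apply_right]

/-- For a PPV-ring `R` and a `θ`-homomorphism `f : R → R_L`, the `L`-linear extension of `f` is an
automorphism. -/
theorem IsPPVRing.bijective_liftConst_includeRight (hR : D.IsPPVRing) {f : R →ₐ[F] R ⊗[K] L}
    (hf : D.IsThetaHom (D.triv L) f) : Function.Bijective
      (liftConst f (Algebra.TensorProduct.includeRight : L →ₐ[K] R ⊗[K] L)) := by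
  have := hR.simple.1
  set σ := liftConst f (Algebra.TensorProduct.includeRight : L →ₐ[K] R ⊗[K] L) with hσ
  have hr : ∀ a : L, σ (1 ⊗ₜ a) = 1 ⊗ₜ a := fun a => by simp [hσ]
  have hθ : (D.triv L).IsThetaHom (D.triv L) σ := hf.liftConst D.tmul_mem_constants_triv
  have hconst : ∀ x ∈ (D.triv L).toHigherDerivation.constants, x ∈ σ.range := fun x hx => by
    obtain ⟨a, rfl⟩ := exists_of_mem_constants_triv hR.constants L hx
    exact ⟨1 ⊗ₜ a, hr a⟩
  refine ⟨hθ.injective_of_triv hR.simple hR.constants L fun a ha => ?_, fun x => ?_⟩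
  · rw [hr] at ha
    exact Algebra.TensorProduct.includeRight_injective (algebraMap K R).injective
      (ha.trans (TensorProduct.tmul_zero _ _).symm)
  -- The range contains `f(R)` and all constants `1 ⊗ L`, so it contains the standard copy of `R`
  -- too.
  · have hl := hR.mem_of_isThetaHom hf (D.isThetaHom_includeLeft_triv L) σ.range
      (fun r => ⟨r ⊗ₜ 1, by simp [hσ, ← Algebra.TensorProduct.one_def]⟩) hconst
    change x ∈ σ.range
    induction x using TensorProduct.induction_on with
    | zero => exact Subalgebra.zero_mem _
    | add x₁ x₂ h₁ h₂ => exact Subalgebra.add_mem _ h₁ h₂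
    | tmul r a =>
      have h : r ⊗ₜ[K] a = (r ⊗ₜ 1) * (1 ⊗ₜ a) := by simp
      rw [h]
      exact Subalgebra.mul_mem _ (hl r) ⟨1 ⊗ₜ a, hr a⟩

/-- The automorphism of `R_L` defined by a `θ`-homomorphism `R → R_L`. -/
def IsPPVRing.autOfHom (hR : D.IsPPVRing) (f : R →ₐ[F] R ⊗[K] L)
    (hf : D.IsThetaHom (D.triv L) f) : autGroup D L :=
  ⟨AlgEquiv.ofBijective _ (hR.bijective_liftConst_includeRight hf),
    hf.liftConst D.tmul_mem_constants_triv, by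
      rintro _ ⟨y, rfl⟩
      rw [AlgEquiv.ofBijective_apply]
      induction y using TensorProduct.induction_on with
      | zero => simp
      | add x₁ x₂ h₁ h₂ => rw [map_add, map_add, h₁, h₂]
      | tmul c a =>
        change liftConst f _ ((algebraMap F R c) ⊗ₜ a) = (algebraMap F R c) ⊗ₜ a
        rw [liftConst_tmul, AlgHom.commutes, Algebra.TensorProduct.algebraMap_apply]
        simp⟩

theorem IsPPVRing.autOfHom_apply (hR : D.IsPPVRing) (f : R →ₐ[F] R ⊗[K] L)
    (hf : D.IsThetaHom (D.triv L) f) (r : R) : (hR.autOfHom f hf).1 (r ⊗ₜ 1) = f r := by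
  change liftConst f _ (r ⊗ₜ 1) = f r
  rw [liftConst_tmul, map_one, mul_one]

/-- The automorphism of `R_L` defined by a homomorphism `u : C_{R ⊗ R} → L`. -/
def IsPPVRing.autOf (hR : D.IsPPVRing) (u : (D.tensor D).toHigherDerivation.constants →ₐ[K] L) :
    autGroup D L :=
  -- The right copy of `R` in `R ⊗[F] R ≃ R ⊗[K] U` is the universal `θ`-homomorphism; `u`
  -- specialises it.
  hR.autOfHom ((baseMap F R u).comp
      (hR.constEquiv.symm.toAlgHom.comp Algebra.TensorProduct.includeRight))
    ((D.isThetaHom_baseMap u).comp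
      (hR.isThetaHom_constEquiv.symm.comp (D.isThetaHom_includeRight D)))

theorem IsPPVRing.autOf_apply (hR : D.IsPPVRing)
    (u : (D.tensor D).toHigherDerivation.constants →ₐ[K] L) (r : R) :
    (hR.autOf u).1 (r ⊗ₜ 1) = baseMap F R u (hR.constEquiv.symm (1 ⊗ₜ r)) :=
  hR.autOfHom_apply _ _ r

/-- Two homomorphisms out of `R ⊗_K U ≃ R ⊗_F R` that agree on both copies of `R` are equal. -/
theorem IsPPVRing.algHom_ext (hR : D.IsPPVRing) {S : Type*} [CommRing S] [Algebra F S]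
    {f g : R ⊗[K] (D.tensor D).toHigherDerivation.constants →ₐ[F] S}
    (hl : ∀ r, f (r ⊗ₜ 1) = g (r ⊗ₜ 1))
    (hr : ∀ r, f (hR.constEquiv.symm (1 ⊗ₜ r)) = g (hR.constEquiv.symm (1 ⊗ₜ r))) : f = g := by
  have h : f.comp hR.constEquiv.symm.toAlgHom = g.comp hR.constEquiv.symm.toAlgHom := by
    refine Algebra.TensorProduct.ext' fun r s => ?_
    have h1 : r ⊗ₜ[F] s = hR.constEquiv (r ⊗ₜ 1) * (1 ⊗ₜ s) := by
      rw [hR.constEquiv_tmul]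
      simp
    rw [h1, map_mul, map_mul]
    congr 1
    · change f (hR.constEquiv.symm (hR.constEquiv _)) = g (hR.constEquiv.symm (hR.constEquiv _))
      rw [AlgEquiv.symm_apply_apply, hl]
    · exact hr s
  ext1 x
  have := AlgHom.congr_fun h (hR.constEquiv x)
  change f (hR.constEquiv.symm _) = g (hR.constEquiv.symm _) at this
  rwa [AlgEquiv.symm_apply_apply] at this

/-- The inverse sends `σ` to the restriction to the constants of `r ⊗ s ↦ r σ(s)`. Uniqueness holds
because the base change of `u` to `R` is known on both copies of `R`, and `L` embeds in `R ⊗[K] L`.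
-/
theorem IsPPVRing.autOf_bijective (hR : D.IsPPVRing) :
    Function.Bijective (hR.autOf (L := L)) := by
  have := hR.simple.1
  have hinj : Function.Injective (Algebra.TensorProduct.includeRight : L →ₐ[K] R ⊗[K] L) :=
    Algebra.TensorProduct.includeRight_injective (algebraMap K R).injective
  refine ⟨fun u v huv => ?_, fun σ => ?_⟩
  · have h : baseMap F R u = baseMap F R v := hR.algHom_ext (fun r => by simp [baseMap])
      fun r => by rw [← hR.autOf_apply, ← hR.autOf_apply, huv]
    ext a
    refine hinj ?_
    simpa [baseMap] using AlgHom.congr_fun h (1 ⊗ₜ a)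
  · let f : R →ₐ[F] R ⊗[K] L :=
      (σ.1 : R ⊗[K] L →ₐ[F] R ⊗[K] L).comp Algebra.TensorProduct.includeLeft
    have hf : D.IsThetaHom (D.triv L) f := IsThetaHom.comp σ.2.1 (D.isThetaHom_includeLeft_triv L)
    let g : R ⊗[F] R →ₐ[F] R ⊗[K] L :=
      Algebra.TensorProduct.productMap Algebra.TensorProduct.includeLeft f
    have hg : (D.tensor D).IsThetaHom (D.triv L) g :=
      (D.isThetaHom_includeLeft_triv L).productMap hf
    -- A `θ`-homomorphism preserves constants, and those of `R ⊗[K] L` are exactly `1 ⊗ L`; this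
    -- produces the values of `u`.
    have hmem : ∀ a : (D.tensor D).toHigherDerivation.constants, g a ∈
        (Algebra.TensorProduct.includeRight : L →ₐ[K] R ⊗[K] L).range := fun a =>
      exists_of_mem_constants_triv hR.constants L (hg.map_constants a.2)
    let u : (D.tensor D).toHigherDerivation.constants →ₐ[K] L :=
      (AlgEquiv.ofInjective _ hinj).symm.toAlgHom.comp
        (((g.restrictScalars K).comp (Subalgebra.val _)).codRestrict _ hmem)
    have hu : ∀ a, (1 : R) ⊗ₜ[K] u a = g a := fun a =>
      congrArg Subtype.val ((AlgEquiv.ofInjective _ hinj).apply_symm_apply ⟨g a, hmem a⟩)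
    have hgu : baseMap F R u = g.comp hR.constEquiv.toAlgHom := by
      refine Algebra.TensorProduct.ext (AlgHom.ext fun r => ?_) (AlgHom.ext fun a => ?_)
      · change baseMap F R u (r ⊗ₜ 1) = g (hR.constEquiv (r ⊗ₜ 1))
        rw [hR.constEquiv_tmul]
        simp [baseMap, g]
      · change baseMap F R u (1 ⊗ₜ a) = g (hR.constEquiv (1 ⊗ₜ a))
        rw [hR.constEquiv_tmul, ← Algebra.TensorProduct.one_def, one_mul, ← hu]
        simp [baseMap]
    refine ⟨u, autGroup_ext fun r => ?_⟩
    rw [hR.autOf_apply, hgu]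
    change g (hR.constEquiv (hR.constEquiv.symm (1 ⊗ₜ r))) = _
    rw [AlgEquiv.apply_symm_apply]
    simp [g, f, ← Algebra.TensorProduct.one_def]

/-- Naturality in `L`: on `R` both sides are specialisations of the same universal homomorphism. -/
theorem IsPPVRing.autMap_autOf (hR : D.IsPPVRing) {L' : Type*} [CommRing L'] [Algebra K L']
    (φ : L →ₐ[K] L') (u : (D.tensor D).toHigherDerivation.constants →ₐ[K] L) :
    autMap D φ (hR.autOf u) = hR.autOf (φ.comp u) := by
  refine autGroup_ext fun r => ?_
  rw [hR.autOf_apply, ← baseMap_baseMap, ← hR.autOf_apply]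
  change autMapHom φ _ (r ⊗ₜ 1) = _
  rw [autMapHom_tmul, ← Algebra.TensorProduct.one_def, mul_one]
  rfl

end AutOf

/-! ### The torsor property and representability -/

/-- With `x` fixed, a second point `y` amounts to a map `R ⊗[F] R → S` equal to `x` on the left
copy. Through `constEquiv` this is the same as a `K`-homomorphism from the constants to `S`, that
is, a group element. -/
theorem IsPPVRing.pointAct_bijective (hR : D.IsPPVRing) {S : Type*} [CommRing S] [Algebra F S]
    [Algebra K S] [IsScalarTower K F S] (x : R →ₐ[F] S) :
    Function.Bijective (pointAct D x : autGroup D S → (R →ₐ[F] S)) := by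
  have happly : ∀ (u : (D.tensor D).toHigherDerivation.constants →ₐ[K] S) r,
      pointAct D x (hR.autOf u) r =
        pointExt x (baseMap F R u (hR.constEquiv.symm (1 ⊗ₜ r))) := fun u r => by
    rw [pointAct_apply, hR.autOf_apply]
  have hbase : ∀ (u : (D.tensor D).toHigherDerivation.constants →ₐ[K] S) r a,
      pointExt x (baseMap F R u (r ⊗ₜ a)) = x r * u a := fun u r a => by
    simp [pointExt, baseMap]
  constructor
  · intro g g' hgg'
    obtain ⟨u, rfl⟩ := hR.autOf_bijective.2 g
    obtain ⟨v, rfl⟩ := hR.autOf_bijective.2 g'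
    have h : (pointExt (K := K) x).comp (baseMap F R u) =
        (pointExt (K := K) x).comp (baseMap F R v) := by
      refine hR.algHom_ext (fun r => ?_) fun r => ?_
      · rw [AlgHom.comp_apply, AlgHom.comp_apply, hbase, hbase, map_one, map_one]
      · rw [AlgHom.comp_apply, AlgHom.comp_apply, ← happly, ← happly, hgg']
    congr 1
    ext a
    have := AlgHom.congr_fun h (1 ⊗ₜ a)
    rwa [AlgHom.comp_apply, AlgHom.comp_apply, hbase, hbase, map_one, one_mul, one_mul] at this
  · intro y
    let g : R ⊗[F] R →ₐ[F] S := Algebra.TensorProduct.productMap x y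
    -- The group element carrying `x` to `y` is read off by restricting the pair `(x, y)` to the
    -- constants.
    let u : (D.tensor D).toHigherDerivation.constants →ₐ[K] S :=
      (g.restrictScalars K).comp (Subalgebra.val _)
    have h : ∀ z, pointExt x (baseMap F R u z) = g (hR.constEquiv z) := fun z => by
      induction z using TensorProduct.induction_on with
      | zero => simp
      | add x₁ x₂ h₁ h₂ => simp only [map_add, h₁, h₂]
      | tmul r a =>
        rw [hbase, hR.constEquiv_tmul, map_mul]
        simp [g, u]
    refine ⟨hR.autOf u, AlgHom.ext fun r => ?_⟩
    rw [happly, h, AlgEquiv.apply_symm_apply]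
    simp [g]

/-- The constants of `R ⊗_F R` represent the functor `L ↦ Aut^θ(R_L / F_L)`. -/
def IsPPVRing.corepresentableBy {R : Type u} [CommRing R] [Algebra F R] [Algebra K R]
    [IsScalarTower K F R] {D : Extension θ R} (hR : D.IsPPVRing) :
    (autFunctor D ⋙ forget GrpCat).CorepresentableBy
      (CommAlgCat.of K (D.tensor D).toHigherDerivation.constants) where
  homEquiv {L} := Equiv.ofBijective
    (fun u : CommAlgCat.of K (D.tensor D).toHigherDerivation.constants ⟶ L =>
      (hR.autOf u.hom : autGroup D L))
    (hR.autOf_bijective.comp (ConcreteCategory.homEquiv (C := CommAlgCat K)).bijective)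
  homEquiv_comp φ u := (hR.autMap_autOf φ.hom u.hom).symm

/-- A nonzero algebra over a field is faithfully flat, and finite type over a field implies finite
presentation. Bijectivity is checked on the fibre over each first coordinate `x`. -/
theorem IsPPVRing.isTorsor {R : Type u} [CommRing R] [Algebra F R] [Algebra K R]
    [IsScalarTower K F R] {D : Extension θ R} (hR : D.IsPPVRing) : IsTorsor (pointAction D) where
  faithfullyFlat := by
    have := hR.simple.1
    infer_instance
  finitePresentation := Algebra.FinitePresentation.of_finiteType.1 hR.finiteType
  bijective S := by
    -- This must be the structure that `restrict` puts on `S`, so that the points of the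
    -- base-changed group are `autGroup D S` by definition.
    let _ : Algebra K S := Algebra.compHom S (algebraMap K F)
    have _ : IsScalarTower K F S := IsScalarTower.of_algebraMap_eq fun _ => rfl
    have h : ∀ x : CommAlgCat.of F R ⟶ S, Function.Bijective
        fun g : autGroup D S => CommAlgCat.ofHom (pointAct (S := S) D x.hom g) := fun x =>
      (ConcreteCategory.homEquiv (C := CommAlgCat F)).symm.bijective.comp (hR.pointAct_bijective x.hom)
    constructor
    · rintro ⟨x, g⟩ ⟨x', g'⟩ hxg
      obtain ⟨rfl, h2⟩ := Prod.mk.inj hxg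
      exact Prod.ext rfl ((h x).1 h2)
    · rintro ⟨x, y⟩
      obtain ⟨g, hg⟩ := (h x).2 y
      exact ⟨(x, g), Prod.ext rfl hg⟩

end Extension

end

end PPV

theorem proposition9p8
    {K F B : Type*} [Field K] [Field F] [Algebra K F] [CommRing B] [Algebra F B] [Algebra K B]
    [IsScalarTower K F B]
    -- `Ω` is the completion of the graded `F`-algebra `⨁ₖ 𝒜 k` with `𝒜 0 = F`; it is a domain
    (𝒜 : ℕ → Submodule F B) [GradedAlgebra 𝒜]
    (h𝒜 : 𝒜 0 = Subalgebra.toSubmodule (⊥ : Subalgebra F B)) [IsDomain (PPV.Cga 𝒜)]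
    -- an iterable higher derivation `θ : F → Ω` with constants `K`
    (θ : PPV.HigherDerivation K 𝒜) (hθ : θ.IsIterable) (hK : θ.constants = ⊥)
    -- a pseudo Picard-Vessiot ring `R` over `F`
    {R : Type*} [CommRing R] [Algebra F R] [Algebra K R] [IsScalarTower K F R]
    (D : PPV.Extension θ R) (hR : D.IsPPVRing) :
    -- the constants of `R ⊗_F R` are a finitely generated `K`-algebra
    Algebra.FiniteType K (D.tensor D).toHigherDerivation.constants ∧
    -- which represents the group functor `L ↦ Aut^θ(R_L / F_L)`
    Nonempty ((PPV.autFunctor D ⋙ CategoryTheory.forget GrpCat).CorepresentableBy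
      (CommAlgCat.of K (D.tensor D).toHigherDerivation.constants)) ∧
    -- and `Spec R` is a torsor under the base change to `F` of that group functor
    PPV.IsTorsor (PPV.pointAction D) := by
  exact ⟨hR.finiteType_constants, ⟨hR.corepresentableBy⟩, hR.isTorsor⟩
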